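/- Let $c_{00}$ be the vector space of finitely supported real sequences with unit vector basis $(e_i)$, let $f(n)=\log_2(n+1)$, and let $S$ be the completion of $c_{00}$ under the unique norm on $c_{00}$ satisfying $$\|x\|=\max\Bigl(\|x\|_{\ell_\infty},\ \sup\Bigl\{\tfrac1{f(n)}\sum_{i=1}^n\|E_ix\| : n\ge 2,\ E_1<E_2<\dots<E_n\Bigr\}\Bigr),$$ where the $E_i$ are finite subsets of $\mathbb N$, $E<F$ means that every element of $E$ is smaller than every element of $F$, and $Ex=\sum_{i\in E}x_ie_i$ for $x=\sum_i x_ie_i$. **Theorem.** $S$ is complementably minimal: every infinite-dimensional closed subspace of $S$ contains a closed subspace which is isomorphic to $S$ (linearly homeomorphic) and complemented in $S$. Moreover, every block basis $(z_n)$ of $(e_n)$ has a further block basis $(y_n)$ which is normalized, is equivalent to $(e_n)$, and whose closed linear span is complemented in $S$. Here a block basis of a sequence $(u_i)$ is a sequence $y_n=\sum_i a_n(i)u_i$ with nonzero $a_n\in c_{00}$ and $\operatorname{supp}a_1<\operatorname{supp}a_2<\cdots$, and $(y_n)$ is equivalent to $(e_n)$ if there is $c\ge1$ with $\frac1c\|\sum_i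 a_ie_i\|\le\|\sum_i a_iy_i\|\le c\|\sum_i a_ie_i\|$ for all $(a_i)\in c_{00}$. -/

import Mathlib

namespace SchlumprechtSpace

/-- The function `f(n) = log₂(n+1)`. -/
noncomputable def f (n : ℕ) : ℝ := Real.logb 2 ((n : ℝ) + 1)

/-- `E_1 < E_2 < ... < E_n` for finite sets of natural numbers. Empty sets are allowed;
they contribute `0` to every sum below, so they do not affect any supremum. -/
def Successive {n : ℕ} (E : Fin n → Finset ℕ) : Prop :=
  ∀ i j, i < j → ∀ a ∈ E i, ∀ b ∈ E j, a < b

/-- The projection `E(x) = ∑_{i ∈ E} x_i e_i` on `c₀₀`. -/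
noncomputable def proj (E : Finset ℕ) (x : ℕ →₀ ℝ) : ℕ →₀ ℝ :=
  x.filter (fun i => i ∈ E)

/-- The `ℓ_∞` norm on `c₀₀`. -/
noncomputable def supNorm (x : ℕ →₀ ℝ) : ℝ := ⨆ i, |x i|

/-- The set of all numbers whose supremum is the right-hand side of the implicit equation
`‖x‖ = ‖x‖_∞ ∨ sup { f(n)⁻¹ ∑_{i ≤ n} ‖E_i x‖ : n ≥ 2, E_1 < ... < E_n }`,
with `‖·‖` replaced by an arbitrary function `N` on the right. -/
def values (N : (ℕ →₀ ℝ) → ℝ) (x : ℕ →₀ ℝ) : Set ℝ :=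
  {r | r = supNorm x ∨ ∃ n : ℕ, 2 ≤ n ∧ ∃ E : Fin n → Finset ℕ, Successive E ∧
    r = 1 / f n * ∑ i, N (proj (E i) x)}

/-- `N` solves the implicit equation defining the norm of `S`. -/
def SolvesImplicitEquation (N : (ℕ →₀ ℝ) → ℝ) : Prop :=
  ∀ x, IsLUB (values N x) (N x)

/-- The iterates of the right-hand side of the implicit equation, starting from `‖·‖_∞`. -/
noncomputable def iter : ℕ → (ℕ →₀ ℝ) → ℝ
  | 0, x => supNorm x
  | k + 1, x => sSup (values (iter k) x)

/-- The norm of `S` on `c₀₀`. It is a norm, solves the implicit equation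
(`sNorm_solves`) and is the only (semi)norm doing so (`eq_sNorm_of_solves`). -/
noncomputable def sNorm (x : ℕ →₀ ℝ) : ℝ := ⨆ k, iter k x

noncomputable def ell1 (x : ℕ →₀ ℝ) : ℝ := ∑ i ∈ x.support, |x i|

theorem one_lt_f {n : ℕ} (hn : 2 ≤ n) : 1 < f n := by
  unfold f
  rw [Real.lt_logb_iff_rpow_lt (by norm_num) (by positivity)]
  have : (2 : ℝ) ≤ n := by exact_mod_cast hn
  norm_num
  linarith

theorem f_mono {m n : ℕ} (h : m ≤ n) : f m ≤ f n := by
  unfold f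
  have : (m : ℝ) ≤ n := by exact_mod_cast h
  exact Real.logb_le_logb_of_le (by norm_num) (by positivity) (by linarith)

theorem abs_le_ell1 (x : ℕ →₀ ℝ) (i : ℕ) : |x i| ≤ ell1 x := by
  by_cases h : i ∈ x.support
  · exact Finset.single_le_sum (f := fun i => |x i|) (fun _ _ => abs_nonneg _) h
  · rw [Finsupp.notMem_support_iff.1 h, abs_zero]
    exact Finset.sum_nonneg fun _ _ => abs_nonneg _

theorem bdd_abs (x : ℕ →₀ ℝ) : BddAbove (Set.range fun i => |x i|) :=
  ⟨ell1 x, by rintro _ ⟨i, rfl⟩; exact abs_le_ell1 x i⟩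

theorem abs_le_supNorm (x : ℕ →₀ ℝ) (i : ℕ) : |x i| ≤ supNorm x :=
  le_ciSup (bdd_abs x) i

theorem supNorm_le_ell1 (x : ℕ →₀ ℝ) : supNorm x ≤ ell1 x := ciSup_le (abs_le_ell1 x)

theorem supNorm_nonneg (x : ℕ →₀ ℝ) : 0 ≤ supNorm x :=
  (abs_nonneg _).trans (abs_le_supNorm x 0)

theorem Successive.eq_of_mem {n : ℕ} {E : Fin n → Finset ℕ} (hE : Successive E) {i j : Fin n}
    {a : ℕ} (hi : a ∈ E i) (hj : a ∈ E j) : i = j := by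
  rcases lt_trichotomy i j with h | h | h
  · exact absurd (hE i j h a hi a hj) (lt_irrefl _)
  · exact h
  · exact absurd (hE j i h a hj a hi) (lt_irrefl _)

theorem ell1_proj (E : Finset ℕ) (x : ℕ →₀ ℝ) :
    ell1 (proj E x) = ∑ a ∈ x.support, if a ∈ E then |x a| else 0 := by
  unfold ell1 proj
  rw [Finsupp.support_filter, Finset.sum_filter]
  refine Finset.sum_congr rfl fun a _ => ?_
  split_ifs with h
  · rw [Finsupp.filter_apply_pos _ _ h]
  · rfl

theorem sum_ell1_le {n : ℕ} {E : Fin n → Finset ℕ} (hE : Successive E) (x : ℕ →₀ ℝ) :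
    ∑ i, ell1 (proj (E i) x) ≤ ell1 x := by
  simp only [ell1_proj]
  rw [Finset.sum_comm]
  refine Finset.sum_le_sum fun a _ => ?_
  by_cases h : ∃ i, a ∈ E i
  · obtain ⟨i, hi⟩ := h
    rw [Finset.sum_eq_single i]
    · rw [if_pos hi]
    · intro j _ hj
      rw [if_neg fun h' => hj (hE.eq_of_mem h' hi)]
    · simp
  · push Not at h
    rw [Finset.sum_eq_zero fun i _ => if_neg (h i)]
    exact abs_nonneg _

theorem inv_f_mul_le {n : ℕ} (hn : 2 ≤ n) {a b : ℝ} (ha : 0 ≤ a) (h : a ≤ b) :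
    1 / f n * a ≤ b := by
  have h1 := one_lt_f hn
  have : 1 / f n ≤ 1 := by rw [div_le_one (by linarith)]; exact h1.le
  calc 1 / f n * a ≤ 1 * a := mul_le_mul_of_nonneg_right this ha
    _ ≤ b := by linarith

theorem le_ell1_of_mem_values {N : (ℕ →₀ ℝ) → ℝ} (h0 : ∀ x, 0 ≤ N x) (h1 : ∀ x, N x ≤ ell1 x)
    {x : ℕ →₀ ℝ} {r : ℝ} (hr : r ∈ values N x) : r ≤ ell1 x := by
  rcases hr with rfl | ⟨n, hn, E, hE, rfl⟩
  · exact supNorm_le_ell1 x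
  · exact inv_f_mul_le hn (Finset.sum_nonneg fun _ _ => h0 _)
      ((Finset.sum_le_sum fun _ _ => h1 _).trans (sum_ell1_le hE x))

theorem iter_bounds (k : ℕ) : (∀ x, 0 ≤ iter k x) ∧ ∀ x, iter k x ≤ ell1 x := by
  induction k with
  | zero => exact ⟨supNorm_nonneg, supNorm_le_ell1⟩
  | succ k ih =>
    refine ⟨fun x => ?_, fun x => ?_⟩
    · exact (supNorm_nonneg x).trans
        (le_csSup ⟨ell1 x, fun r hr => le_ell1_of_mem_values ih.1 ih.2 hr⟩ (Or.inl rfl))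
    · exact csSup_le ⟨_, Or.inl rfl⟩ fun r hr => le_ell1_of_mem_values ih.1 ih.2 hr

theorem le_iter_succ (k : ℕ) {x : ℕ →₀ ℝ} {r : ℝ} (hr : r ∈ values (iter k) x) :
    r ≤ iter (k + 1) x :=
  le_csSup ⟨ell1 x, fun _ hr => le_ell1_of_mem_values (iter_bounds k).1 (iter_bounds k).2 hr⟩ hr

theorem iter_succ_le (k : ℕ) {x : ℕ →₀ ℝ} {b : ℝ} (h : ∀ r ∈ values (iter k) x, r ≤ b) :
    iter (k + 1) x ≤ b :=
  csSup_le ⟨_, Or.inl rfl⟩ h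

theorem inv_f_nonneg {n : ℕ} (hn : 2 ≤ n) : 0 ≤ 1 / f n := by
  have := one_lt_f hn
  positivity

theorem iter_le_succ (k : ℕ) (x : ℕ →₀ ℝ) : iter k x ≤ iter (k + 1) x := by
  induction k generalizing x with
  | zero => exact le_iter_succ 0 (Or.inl rfl)
  | succ k ih =>
    refine iter_succ_le k ?_
    rintro r (rfl | ⟨n, hn, E, hE, rfl⟩)
    · exact le_iter_succ _ (Or.inl rfl)
    · exact (mul_le_mul_of_nonneg_left (Finset.sum_le_sum fun _ _ => ih _)
        (inv_f_nonneg hn)).trans (le_iter_succ (k + 1) (Or.inr ⟨n, hn, E, hE, rfl⟩))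

theorem bdd_iter (x : ℕ →₀ ℝ) : BddAbove (Set.range fun k => iter k x) :=
  ⟨ell1 x, by rintro _ ⟨k, rfl⟩; exact (iter_bounds k).2 x⟩

theorem iter_le_sNorm (k : ℕ) (x : ℕ →₀ ℝ) : iter k x ≤ sNorm x := le_ciSup (bdd_iter x) k

theorem supNorm_le_sNorm (x : ℕ →₀ ℝ) : supNorm x ≤ sNorm x := iter_le_sNorm 0 x

/-- The norm of `S` satisfies the implicit equation. -/
theorem sNorm_solves : SolvesImplicitEquation sNorm := by
  intro x
  refine ⟨?_, fun b hb => ciSup_le fun k => ?_⟩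
  · rintro r (rfl | ⟨n, hn, E, hE, rfl⟩)
    · exact supNorm_le_sNorm x
    · have ht : ∀ z, Filter.Tendsto (fun k => iter k z) Filter.atTop (nhds (sNorm z)) :=
        fun z => tendsto_atTop_ciSup (monotone_nat_of_le_succ fun k => iter_le_succ k z)
          (bdd_iter z)
      refine le_of_tendsto'
        ((tendsto_finsetSum _ fun i _ => ht (proj (E i) x)).const_mul (1 / f n)) fun k => ?_
      exact (le_iter_succ k (Or.inr ⟨n, hn, E, hE, rfl⟩)).trans (iter_le_sNorm _ _)
  · cases k with
    | zero => exact hb (Or.inl rfl)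
    | succ k =>
      refine iter_succ_le k ?_
      rintro r (rfl | ⟨n, hn, E, hE, rfl⟩)
      · exact hb (Or.inl rfl)
      · exact (mul_le_mul_of_nonneg_left (Finset.sum_le_sum fun _ _ => iter_le_sNorm _ _)
          (inv_f_nonneg hn)).trans (hb (Or.inr ⟨n, hn, E, hE, rfl⟩))

theorem proj_add (E : Finset ℕ) (x y : ℕ →₀ ℝ) : proj E (x + y) = proj E x + proj E y :=
  Finsupp.filter_add

theorem proj_smul (E : Finset ℕ) (c : ℝ) (x : ℕ →₀ ℝ) : proj E (c • x) = c • proj E x :=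
  Finsupp.filter_smul

theorem supNorm_add (x y : ℕ →₀ ℝ) : supNorm (x + y) ≤ supNorm x + supNorm y :=
  ciSup_le fun i => (abs_add_le (x i) (y i)).trans
    (add_le_add (abs_le_supNorm x i) (abs_le_supNorm y i))

theorem supNorm_smul_le (c : ℝ) (x : ℕ →₀ ℝ) : supNorm (c • x) ≤ |c| * supNorm x :=
  ciSup_le fun i => by
    rw [Finsupp.smul_apply, smul_eq_mul, abs_mul]
    exact mul_le_mul_of_nonneg_left (abs_le_supNorm x i) (abs_nonneg _)

theorem iter_add (k : ℕ) (x y : ℕ →₀ ℝ) : iter k (x + y) ≤ iter k x + iter k y := by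
  induction k generalizing x y with
  | zero => exact supNorm_add x y
  | succ k ih =>
    refine iter_succ_le k ?_
    rintro r (rfl | ⟨n, hn, E, hE, rfl⟩)
    · exact (supNorm_add x y).trans
        (add_le_add (le_iter_succ k (Or.inl rfl)) (le_iter_succ k (Or.inl rfl)))
    · refine le_trans ?_ (add_le_add (le_iter_succ k (Or.inr ⟨n, hn, E, hE, rfl⟩))
        (le_iter_succ k (Or.inr ⟨n, hn, E, hE, rfl⟩)))
      rw [← mul_add, ← Finset.sum_add_distrib]
      refine mul_le_mul_of_nonneg_left (Finset.sum_le_sum fun i _ => ?_) (inv_f_nonneg hn)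
      rw [proj_add]
      exact ih _ _

theorem iter_smul_le (k : ℕ) (c : ℝ) (x : ℕ →₀ ℝ) : iter k (c • x) ≤ |c| * iter k x := by
  induction k generalizing x with
  | zero => exact supNorm_smul_le c x
  | succ k ih =>
    refine iter_succ_le k ?_
    rintro r (rfl | ⟨n, hn, E, hE, rfl⟩)
    · exact (supNorm_smul_le c x).trans
        (mul_le_mul_of_nonneg_left (le_iter_succ k (Or.inl rfl)) (abs_nonneg _))
    · refine le_trans ?_ (mul_le_mul_of_nonneg_left
        (le_iter_succ k (Or.inr ⟨n, hn, E, hE, rfl⟩)) (abs_nonneg c))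
      rw [mul_left_comm, Finset.mul_sum (f := fun i => iter k (proj (E i) x)) (a := |c|)]
      refine mul_le_mul_of_nonneg_left (Finset.sum_le_sum fun i _ => ?_) (inv_f_nonneg hn)
      rw [proj_smul]
      exact ih _

/-- The norm of `S` on `c₀₀`, bundled as a seminorm. -/
noncomputable def sSeminorm : Seminorm ℝ (ℕ →₀ ℝ) :=
  Seminorm.ofSMulLE sNorm
    (le_antisymm (ciSup_le fun k => by simpa using iter_smul_le k 0 0)
      ((supNorm_nonneg 0).trans (supNorm_le_sNorm 0)))
    (fun x y => ciSup_le fun k => (iter_add k x y).trans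
      (add_le_add (iter_le_sNorm k x) (iter_le_sNorm k y)))
    (fun c x => ciSup_le fun k => (iter_smul_le k c x).trans
      (mul_le_mul_of_nonneg_left (iter_le_sNorm k x) (abs_nonneg c)))

theorem eq_zero_of_sNorm_eq_zero {x : ℕ →₀ ℝ} (h : sNorm x = 0) : x = 0 := by
  ext i
  have := (abs_le_supNorm x i).trans (supNorm_le_sNorm x)
  rw [h] at this
  exact abs_nonpos_iff.1 this

theorem le_of_solves {M N : Seminorm ℝ (ℕ →₀ ℝ)} (hM : SolvesImplicitEquation M)
    (hN : SolvesImplicitEquation N) (x : ℕ →₀ ℝ)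
    (ih : ∀ y : ℕ →₀ ℝ, y.support.card < x.support.card → N y = M y) : N x ≤ M x := by
  have h2 := one_lt_f le_rfl
  have key : N x ≤ max (M x) (N x / f 2) := by
    refine (hN x).2 ?_
    rintro r (rfl | ⟨n, hn, E, hE, rfl⟩)
    · exact ((hM x).1 (Or.inl rfl)).trans (le_max_left _ _)
    · by_cases h : ∃ i, x.support ⊆ E i
      · obtain ⟨i, hi⟩ := h
        refine le_trans ?_ (le_max_right _ _)
        rw [Finset.sum_eq_single i]
        · have : proj (E i) x = x := by
            rw [proj, Finsupp.filter_eq_self_iff]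
            exact fun a ha => hi (Finsupp.mem_support_iff.2 ha)
          rw [this, one_div_mul_eq_div]
          exact div_le_div_of_nonneg_left (apply_nonneg N x) (by linarith) (f_mono hn)
        · intro j _ hj
          have : proj (E j) x = 0 := by
            rw [proj, Finsupp.filter_eq_zero_iff]
            intro a ha
            by_contra hax
            exact hj (hE.eq_of_mem ha (hi (Finsupp.mem_support_iff.2 hax)))
          rw [this, map_zero]
        · simp
      · push Not at h
        refine le_trans (le_of_eq ?_) (((hM x).1 (Or.inr ⟨n, hn, E, hE, rfl⟩)).trans
          (le_max_left _ _))
        congr 1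
        refine Finset.sum_congr rfl fun i _ => ih _ (Finset.card_lt_card ?_)
        rw [proj, Finsupp.support_filter, Finset.filter_ssubset]
        obtain ⟨a, ha, ha'⟩ := Finset.not_subset.1 (h i)
        exact ⟨a, ha, ha'⟩
  rcases le_max_iff.1 key with h | h
  · exact h
  · rw [le_div_iff₀ (by linarith)] at h
    have := apply_nonneg N x
    have := apply_nonneg M x
    nlinarith

/-- Uniqueness of the solution of the implicit equation among (semi)norms on `c₀₀`. -/
theorem eq_sNorm_of_solves (N : Seminorm ℝ (ℕ →₀ ℝ)) (hN : SolvesImplicitEquation N)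
    (x : ℕ →₀ ℝ) : N x = sNorm x := by
  have hS : SolvesImplicitEquation sSeminorm := sNorm_solves
  suffices h : ∀ (m : ℕ) (x : ℕ →₀ ℝ), x.support.card = m → N x = sSeminorm x from h _ x rfl
  intro m
  induction m using Nat.strong_induction_on with
  | _ m ih =>
    rintro x rfl
    exact le_antisymm (le_of_solves hS hN x fun y hy => ih _ hy y rfl)
      (le_of_solves hN hS x fun y hy => (ih _ hy y rfl).symm)

/-- The vector space `c₀₀` of finitely supported real sequences, carrying the norm of `S`. -/
def C00 : Type := ℕ →₀ ℝ

noncomputable instance : AddCommGroup C00 := inferInstanceAs (AddCommGroup (ℕ →₀ ℝ))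

noncomputable instance : Module ℝ C00 := inferInstanceAs (Module ℝ (ℕ →₀ ℝ))

noncomputable instance : NormedAddCommGroup C00 :=
  AddGroupNorm.toNormedAddCommGroup (E := C00)
    { sSeminorm.toAddGroupSeminorm with
      eq_zero_of_map_eq_zero' := fun _ h => eq_zero_of_sNorm_eq_zero h }

noncomputable instance : NormedSpace ℝ C00 where
  norm_smul_le c x := (sSeminorm.smul' c x).le

theorem norm_C00 (x : ℕ →₀ ℝ) : ‖(show C00 from x)‖ = sNorm x := rfl

/-- The Banach space `S`: the completion of `c₀₀` under the norm of `S`. -/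
abbrev S : Type := UniformSpace.Completion C00

/-- The unit vector basis `(e_n)` of `S` (indexed from `0`). -/
noncomputable def e (n : ℕ) : S :=
  ((show C00 from Finsupp.single n (1 : ℝ) : C00) : UniformSpace.Completion C00)

end SchlumprechtSpace

/-- A Banach space `X` is complementably minimal if every infinite-dimensional (closed) subspace
of `X` contains a (closed) subspace which is isomorphic to `X` and complemented in `X`. -/
def ComplementablyMinimal (X : Type*) [NormedAddCommGroup X] [NormedSpace ℝ X]
    [CompleteSpace X] : Prop :=
  ∀ Y : Submodule ℝ X, IsClosed (Y : Set X) → ¬ FiniteDimensional ℝ Y →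
    ∃ Z : Submodule ℝ X, Z ≤ Y ∧ IsClosed (Z : Set X) ∧ Nonempty (Z ≃L[ℝ] X) ∧
      Z.ClosedComplemented

/-- `y` is a block basis of the sequence `z`: `y_n = ∑_i a_n(i) z_i` with nonzero finitely
supported coefficient vectors `a_0 < a_1 < ...`. -/
def IsBlockBasisOf {X : Type*} [AddCommGroup X] [Module ℝ X] (y z : ℕ → X) : Prop :=
  ∃ a : ℕ → ℕ →₀ ℝ, (∀ n, a n ≠ 0) ∧
    (∀ m n, m < n → ∀ i ∈ (a m).support, ∀ j ∈ (a n).support, i < j) ∧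
    ∀ n, y n = (a n).sum fun i c => c • z i

/-- Two sequences `x`, `y` are equivalent: for some `c ≥ 1`, and all `a ∈ c₀₀`,
`(1/c) ‖∑ a_i y_i‖ ≤ ‖∑ a_i x_i‖ ≤ c ‖∑ a_i y_i‖`. -/
def EquivalentSeq {X : Type*} [NormedAddCommGroup X] [NormedSpace ℝ X] (x y : ℕ → X) : Prop :=
  ∃ c : ℝ, 1 ≤ c ∧ ∀ a : ℕ →₀ ℝ,
    1 / c * ‖a.sum fun i t => t • y i‖ ≤ ‖a.sum fun i t => t • x i‖ ∧
      ‖a.sum fun i t => t • x i‖ ≤ c * ‖a.sum fun i t => t • y i‖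

namespace SchlumprechtSpace

/-! Lower estimates in `S` are free: a normalized block sequence always dominates the unit vector
basis (`sNorm_le_of_blocks`). Applying norming functionals on the successive supports therefore
gives a contraction `U` of `S` with `U y_n = e_n` (`IsBlock.exists_coordinates`). If the basis also
dominates `(y_n)`, then `V : e_n ↦ y_n` is bounded, `U V = 1`, and `V U` projects onto the closed
span. Everything thus rests on finding, in every block subspace, blocks with an upper estimate.

These blocks are averages of `k_n` successive vectors that behave like an `ℓ₁` basis, with `k_n`
growing very fast. They exist because `f` grows only logarithmically (`IsBlock.exists_ell1`).
Between thresholds `M_n`, a tree functional node of size `m` interacts badly with at most one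
average. If `m < M_n`, the node splits average `n` with little loss. If `m ≥ M_{n+1}`, its weight `1
/ f m` kills average `n`. Only the `n` with `M_n ≤ m < M_{n+1}` is uncontrolled. So, up to summable
errors, the functional acts on the averages like a tree functional on the basis in which each large
node may carry one extra coordinate with full weight (`NormingOn.exists_adm`).

It remains to see that these extra coordinates are harmless (`Adm.bound_and_hasNode`). Let a node
have weight `1 / F`, with `F` large. Children with weight parameter at most `√F` are absorbed into
the node, since multiplying the number of pieces by `2 ^ √F` changes `f` only by about `√F`.
Children between `√F` and `4F` gain a factor of order `1 / √F`. Children beyond `4F` satisfy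
inductively a bound with half the error term. The errors do not accumulate with depth, and every
such sequence is bounded by `6` times the norm.

For an arbitrary infinite-dimensional subspace, a gliding hump gives almost-block vectors, and a
Neumann series absorbs the perturbation. -/

/-! ### Monotonicity of the norm and successive pieces of a vector. -/

theorem proj_apply (E : Finset ℕ) (x : ℕ →₀ ℝ) (i : ℕ) :
    proj E x i = if i ∈ E then x i else 0 := by
  classical
  rw [proj, Finsupp.filter_apply]

theorem proj_proj (E F : Finset ℕ) (x : ℕ →₀ ℝ) : proj E (proj F x) = proj (E ∩ F) x := by
  ext i
  simp only [proj_apply, Finset.mem_inter]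
  split_ifs <;> tauto

theorem proj_eq_self {E : Finset ℕ} {x : ℕ →₀ ℝ} (h : x.support ⊆ E) : proj E x = x := by
  ext i
  rw [proj_apply]
  split_ifs with hi
  · rfl
  · exact (Finsupp.notMem_support_iff.1 fun hx => hi (h hx)).symm

theorem abs_proj_le (E : Finset ℕ) (x : ℕ →₀ ℝ) (i : ℕ) : |proj E x i| ≤ |x i| := by
  rw [proj_apply]
  split_ifs <;> simp

theorem iter_mono_abs (k : ℕ) {x y : ℕ →₀ ℝ} (h : ∀ i, |x i| ≤ |y i|) : iter k x ≤ iter k y := by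
  induction k generalizing x y with
  | zero => exact ciSup_le fun i => (h i).trans (abs_le_supNorm y i)
  | succ k ih =>
    refine iter_succ_le k ?_
    rintro r (rfl | ⟨n, hn, E, hE, rfl⟩)
    · exact (ciSup_le fun i => (h i).trans (abs_le_supNorm y i)).trans
        (le_iter_succ k (Or.inl rfl))
    · refine le_trans ?_ (le_iter_succ k (Or.inr ⟨n, hn, E, hE, rfl⟩))
      refine mul_le_mul_of_nonneg_left (Finset.sum_le_sum fun j _ => ih fun i => ?_)
        (inv_f_nonneg hn)
      simp only [proj_apply]
      split_ifs
      · exact h i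
      · simp

theorem sNorm_mono_abs {x y : ℕ →₀ ℝ} (h : ∀ i, |x i| ≤ |y i|) : sNorm x ≤ sNorm y :=
  ciSup_le fun k => (iter_mono_abs k h).trans (iter_le_sNorm k y)

theorem sNorm_proj_le (E : Finset ℕ) (x : ℕ →₀ ℝ) : sNorm (proj E x) ≤ sNorm x :=
  sNorm_mono_abs (abs_proj_le E x)

theorem sNorm_nonneg (x : ℕ →₀ ℝ) : 0 ≤ sNorm x := apply_nonneg sSeminorm x

theorem sNorm_zero : sNorm 0 = 0 := map_zero sSeminorm

theorem sNorm_add_le (x y : ℕ →₀ ℝ) : sNorm (x + y) ≤ sNorm x + sNorm y :=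
  map_add_le_add sSeminorm x y

theorem sNorm_smul (c : ℝ) (x : ℕ →₀ ℝ) : sNorm (c • x) = |c| * sNorm x :=
  map_smul_eq_mul sSeminorm c x

theorem abs_le_sNorm (x : ℕ →₀ ℝ) (i : ℕ) : |x i| ≤ sNorm x :=
  (abs_le_supNorm x i).trans (supNorm_le_sNorm x)

theorem sNorm_pos {x : ℕ →₀ ℝ} (h : x ≠ 0) : 0 < sNorm x :=
  (sNorm_nonneg x).lt_of_ne fun h' => h (eq_zero_of_sNorm_eq_zero h'.symm)

theorem f_one : f 1 = 1 := by
  unfold f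
  norm_num

theorem one_le_f {n : ℕ} (hn : 1 ≤ n) : 1 ≤ f n := f_one ▸ f_mono hn

theorem sum_sNorm_proj_le {n : ℕ} (hn : 1 ≤ n) {E : Fin n → Finset ℕ} (hE : Successive E)
    (x : ℕ →₀ ℝ) : ∑ i, sNorm (proj (E i) x) ≤ f n * sNorm x := by
  rcases hn.eq_or_lt with rfl | hn
  · rw [f_one, one_mul, Fin.sum_univ_one]
    exact sNorm_proj_le _ _
  · have h := (sNorm_solves x).1 (Or.inr ⟨n, hn, E, hE, rfl⟩)
    have hf := one_lt_f hn
    rwa [one_div_mul_eq_div, div_le_iff₀ (by linarith), mul_comm] at h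

/-- Every element of `A` is smaller than every element of `B`. -/
def Before (A B : Finset ℕ) : Prop := ∀ a ∈ A, ∀ b ∈ B, a < b

/-- Lists are used, rather than families indexed by `Fin n`, because pieces coming from different
children of a node will be concatenated, and only an upper bound for their number is known. -/
theorem list_sum_sNorm_proj_le {L : List (Finset ℕ)} (hL : L.Pairwise Before) {b : ℝ}
    (hb : f L.length ≤ b) (x : ℕ →₀ ℝ) :
    (L.map fun E => sNorm (proj E x)).sum ≤ b * sNorm x := by
  rcases Nat.eq_zero_or_pos L.length with h0 | h0
  · rw [List.length_eq_zero_iff.1 h0] at hb ⊢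
    have : f 0 = 0 := by simp [f]
    rw [List.length_nil, this] at hb
    exact mul_nonneg hb (sNorm_nonneg x)
  · have hs : Successive (fun i : Fin L.length => L.get i) := by
      intro i j hij
      exact List.pairwise_iff_get.1 hL i j hij
    have := sum_sNorm_proj_le h0 hs x
    rw [← List.sum_ofFn] at this
    have h2 : List.ofFn (fun i : Fin L.length => sNorm (proj (L.get i) x)) =
        L.map fun E => sNorm (proj E x) := by
      conv_rhs => rw [← List.ofFn_get L, List.map_ofFn]
      rfl
    rw [h2] at this
    exact this.trans (mul_le_mul_of_nonneg_right hb (sNorm_nonneg x))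

/-- Norms of successive pieces of a vector are dominated by the vector. -/
theorem sNorm_le_of_blocks {E : ℕ → Finset ℕ} (hE : ∀ m n, m < n → Before (E m) (E n))
    (b x : ℕ →₀ ℝ) (h : ∀ n, |b n| ≤ sNorm (proj (E n) x)) : sNorm b ≤ sNorm x := by
  classical
  refine ciSup_le fun k => ?_
  induction k generalizing b x with
  | zero => exact ciSup_le fun i => (h i).trans (sNorm_proj_le _ _)
  | succ k ih =>
    refine iter_succ_le k ?_
    rintro r (rfl | ⟨n, hn, F, hF, rfl⟩)
    · exact ciSup_le fun i => (h i).trans (sNorm_proj_le _ _)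
    -- Successive sets of indices pull back to successive sets of positions, so a partition that is
    -- good for `b` gives one for `x`.
    · have hs : Successive fun j => (F j).biUnion E := by
        intro i j hij p hp q hq
        obtain ⟨s, hs, hp⟩ := Finset.mem_biUnion.1 hp
        obtain ⟨t, ht, hq⟩ := Finset.mem_biUnion.1 hq
        exact hE s t (hF i j hij s hs t ht) p hp q hq
      refine le_trans ?_ ((sNorm_solves x).1 (Or.inr ⟨n, hn, _, hs, rfl⟩))
      refine mul_le_mul_of_nonneg_left (Finset.sum_le_sum fun j _ => ih _ _ fun i => ?_)
        (inv_f_nonneg hn)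
      rw [proj_apply]
      split_ifs with hi
      · rw [proj_proj, Finset.inter_eq_left.2 (Finset.subset_biUnion_of_mem E hi)]
        exact h i
      · rw [abs_zero]
        exact sNorm_nonneg _

/-! ### Tree functionals and the norm they compute. -/

/-- The tree functionals that norm `c₀₀`, supported in a given finite set. -/
inductive NormingOn : Finset ℕ → (ℕ → ℝ) → Prop
  | zero (E : Finset ℕ) : NormingOn E 0
  | leaf (E : Finset ℕ) (i : ℕ) (s : ℝ) (hi : i ∈ E) (hs : |s| ≤ 1) :
      NormingOn E (Pi.single i s)
  | node (E : Finset ℕ) (m : ℕ) (hm : 2 ≤ m) (G : Fin m → Finset ℕ) (hG : Successive G)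
      (hGE : ∀ j, G j ⊆ E) (φ : Fin m → ℕ → ℝ) (h : ∀ j, NormingOn (G j) (φ j)) :
      NormingOn E (fun n => 1 / f m * ∑ j, φ j n)

/-- The action of a sequence on `c₀₀`. -/
noncomputable def pair (φ : ℕ → ℝ) : (ℕ →₀ ℝ) →ₗ[ℝ] ℝ := Finsupp.linearCombination ℝ φ

theorem pair_apply (φ : ℕ → ℝ) (x : ℕ →₀ ℝ) : pair φ x = ∑ i ∈ x.support, x i * φ i := by
  simp [pair, Finsupp.linearCombination_apply, Finsupp.sum]

theorem pair_node {m : ℕ} (φ : Fin m → ℕ → ℝ) (x : ℕ →₀ ℝ) :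
    pair (fun n => 1 / f m * ∑ j, φ j n) x = 1 / f m * ∑ j, pair (φ j) x := by
  simp only [pair_apply]
  rw [Finset.sum_comm, Finset.mul_sum]
  refine Finset.sum_congr rfl fun i _ => ?_
  rw [← Finset.mul_sum]
  ring

theorem pair_single (i : ℕ) (s : ℝ) (x : ℕ →₀ ℝ) : pair (Pi.single i s) x = x i * s := by
  rw [pair_apply]
  by_cases h : i ∈ x.support
  · rw [Finset.sum_eq_single_of_mem i h]
    · simp
    · intro j _ hj
      simp [Pi.single_eq_of_ne hj]
  · rw [Finset.sum_eq_zero, Finsupp.notMem_support_iff.1 h, zero_mul]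
    intro j hj
    rw [Pi.single_eq_of_ne (ne_of_mem_of_not_mem hj h), mul_zero]

theorem NormingOn.eq_zero {E : Finset ℕ} {φ : ℕ → ℝ} (h : NormingOn E φ) {i : ℕ} (hi : i ∉ E) :
    φ i = 0 := by
  induction h with
  | zero E => rfl
  | leaf E j s hj hs => exact Pi.single_eq_of_ne (M := fun _ => ℝ) (ne_of_mem_of_not_mem hj hi).symm s
  | node E m hm G hG hGE φ h ih =>
    simp only
    rw [Finset.sum_eq_zero fun j _ => ih j fun h' => hi (hGE j h'), mul_zero]

theorem pair_congr {φ : ℕ → ℝ} {x y : ℕ →₀ ℝ} (h : ∀ i, φ i ≠ 0 → x i = y i) :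
    pair φ x = pair φ y := by
  rw [← sub_eq_zero, ← map_sub, pair_apply]
  refine Finset.sum_eq_zero fun i _ => ?_
  by_cases hi : φ i = 0
  · rw [hi, mul_zero]
  · rw [Finsupp.sub_apply, h i hi, sub_self, zero_mul]

theorem NormingOn.pair_proj {E : Finset ℕ} {φ : ℕ → ℝ} (h : NormingOn E φ) (x : ℕ →₀ ℝ) :
    pair φ (proj E x) = pair φ x := by
  refine pair_congr fun i hi => ?_
  rw [proj_apply, if_pos]
  by_contra h'
  exact hi (h.eq_zero h')

theorem NormingOn.abs_pair_le {E : Finset ℕ} {φ : ℕ → ℝ} (h : NormingOn E φ) (x : ℕ →₀ ℝ) :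
    |pair φ x| ≤ sNorm x := by
  induction h generalizing x with
  | zero E =>
    simpa [pair_apply] using sNorm_nonneg x
  | leaf E i s hi hs =>
    rw [pair_single, abs_mul]
    nlinarith [abs_le_sNorm x i, abs_nonneg (x i)]
  | node E m hm G hG hGE φ h ih =>
    rw [pair_node, abs_mul, abs_of_nonneg (inv_f_nonneg hm)]
    refine le_trans ?_ ((sNorm_solves x).1 (Or.inr ⟨m, hm, G, hG, rfl⟩))
    refine mul_le_mul_of_nonneg_left ((Finset.abs_sum_le_sum_abs _ _).trans ?_) (inv_f_nonneg hm)
    exact Finset.sum_le_sum fun j _ => (h j).pair_proj x ▸ ih j _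

theorem NormingOn.abs_le_one {E : Finset ℕ} {φ : ℕ → ℝ} (h : NormingOn E φ) (i : ℕ) :
    |φ i| ≤ 1 := by
  induction h with
  | zero E => simp
  | leaf E j s hj hs =>
    by_cases hij : i = j
    · subst hij; simpa
    · simp [Pi.single_eq_of_ne hij]
  | node E m hm G hG hGE φ h ih =>
    simp only
    rw [abs_mul, abs_of_nonneg (inv_f_nonneg hm)]
    refine inv_f_mul_le hm (abs_nonneg _) ?_
    by_cases hi : ∃ j, i ∈ G j
    · obtain ⟨j, hj⟩ := hi
      rw [Finset.sum_eq_single j]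
      · exact ih j
      · intro l _ hl
        exact (h l).eq_zero fun h' => hl (hG.eq_of_mem h' hj)
      · simp
    · push Not at hi
      rw [Finset.sum_eq_zero fun j _ => (h j).eq_zero (hi j)]
      simp

theorem NormingOn.abs_pair_le_sum {E : Finset ℕ} {φ : ℕ → ℝ} (h : NormingOn E φ) (x : ℕ →₀ ℝ) :
    |pair φ x| ≤ ∑ i ∈ E, |x i| := by
  classical
  rw [← h.pair_proj, pair_apply]
  refine (Finset.abs_sum_le_sum_abs _ _).trans ?_
  have hsub : (proj E x).support ⊆ E := by
    intro i hi
    by_contra h'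
    exact Finsupp.mem_support_iff.1 hi (by rw [proj_apply, if_neg h'])
  refine le_trans (Finset.sum_le_sum fun i hi => ?_)
    (Finset.sum_le_sum_of_subset_of_nonneg hsub fun i _ _ => abs_nonneg (x i))
  rw [abs_mul]
  have := h.abs_le_one i
  have := abs_proj_le E x i
  nlinarith [abs_nonneg (proj E x i), abs_nonneg (φ i)]

/-- Each iterate is a supremum of coordinates or of weighted sums of earlier iterates; near-optimal
choices at every level assemble into a tree. Suprema need not be attained a priori, hence the
tolerance. -/
theorem exists_normingOn (k : ℕ) (x : ℕ →₀ ℝ) {δ : ℝ} (hδ : 0 < δ) {E : Finset ℕ}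
    (hE : x.support ⊆ E) : ∃ φ, NormingOn E φ ∧ iter k x - δ ≤ pair φ x := by
  classical
  have base : ∀ (x : ℕ →₀ ℝ) (δ : ℝ), 0 < δ → ∀ E : Finset ℕ, x.support ⊆ E →
      ∃ φ, NormingOn E φ ∧ supNorm x - δ ≤ pair φ x := by
    intro x δ hδ E hE
    obtain ⟨i, hi⟩ := exists_lt_of_lt_ciSup (show supNorm x - δ < ⨆ i, |x i| by
      change _ < supNorm x; linarith)
    by_cases h0 : x i = 0
    · refine ⟨0, .zero E, ?_⟩
      rw [h0, abs_zero] at hi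
      simpa [pair_apply] using hi.le
    · refine ⟨Pi.single i (SignType.sign (x i)), .leaf E i _ (hE (Finsupp.mem_support_iff.2 h0)) ?_,
        ?_⟩
      · rcases lt_or_gt_of_ne h0 with h | h <;> simp [h]
      · rw [pair_single, self_mul_sign]
        exact hi.le
  induction k generalizing x δ E with
  | zero => exact base x δ hδ E hE
  | succ k ih =>
    obtain ⟨r, hr, hlt⟩ := exists_lt_of_lt_csSup (s := values (iter k) x) ⟨_, Or.inl rfl⟩
      (show sSup (values (iter k) x) - δ / 2 < sSup (values (iter k) x) by linarith)
    change iter (k + 1) x - δ / 2 < r at hlt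
    rcases hr with rfl | ⟨m, hm, G, hG, rfl⟩
    · obtain ⟨φ, h1, h2⟩ := base x (δ / 2) (by linarith) E hE
      exact ⟨φ, h1, by linarith⟩
    · have hm0 : (0 : ℝ) < m := by exact_mod_cast (by omega : 0 < m)
      have hsub : ∀ j, (proj (G j) x).support ⊆ G j ∩ E := by
        intro j i hi
        rw [Finsupp.mem_support_iff, proj_apply] at hi
        rw [Finset.mem_inter]
        by_cases h : i ∈ G j
        · rw [if_pos h] at hi
          exact ⟨h, hE (Finsupp.mem_support_iff.2 hi)⟩
        · simp [h] at hi
      -- Half of `δ` is shared by the `m` children and the other half was spent on choosing the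
      -- partition. Intersecting with `E` keeps the tree supported in the prescribed set.
      choose φ hφ hφ' using fun j => ih (proj (G j) x) (δ := δ / (2 * m)) (by positivity) (hsub j)
      refine ⟨_, .node E m hm (fun j => G j ∩ E) ?_ (fun j => Finset.inter_subset_right) φ hφ, ?_⟩
      · intro i j hij a ha b hb
        exact hG i j hij a (Finset.mem_inter.1 ha).1 b (Finset.mem_inter.1 hb).1
      · rw [pair_node]
        have h1 : ∀ j, pair (φ j) (proj (G j) x) = pair (φ j) x := by
          intro j
          refine pair_congr fun i hi => ?_
          rw [proj_apply, if_pos]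
          by_contra h'
          exact hi ((hφ j).eq_zero fun h'' => h' (Finset.mem_inter.1 h'').1)
        have h2 : ∑ j, iter k (proj (G j) x) - δ / 2 ≤ ∑ j, pair (φ j) x := by
          have h3 := Finset.sum_le_sum fun j (_ : j ∈ Finset.univ) => hφ' j
          simp only [h1] at h3
          rw [Finset.sum_sub_distrib, Finset.sum_const, Finset.card_univ, Fintype.card_fin,
            nsmul_eq_mul] at h3
          have : (m : ℝ) * (δ / (2 * m)) = δ / 2 := by field_simp
          linarith
        have h4 := mul_le_mul_of_nonneg_left h2 (inv_f_nonneg hm)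
        have h5 : 1 / f m * (δ / 2) ≤ δ / 2 := inv_f_mul_le hm (by linarith) le_rfl
        rw [mul_sub] at h4
        linarith

theorem sNorm_le_of_pair_le {x : ℕ →₀ ℝ} {b : ℝ}
    (h : ∀ φ, NormingOn x.support φ → pair φ x ≤ b) : sNorm x ≤ b :=
  ciSup_le fun k => le_of_forall_pos_le_add fun δ hδ => by
    obtain ⟨φ, h1, h2⟩ := exists_normingOn k x hδ (Finset.Subset.refl _)
    linarith [h φ h1]

/-! ### Admissible sequences and their bound by the norm. -/

/-- Nonnegative sequences obtained from tree functionals by adding, at each node of large size,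
one coordinate functional with full weight. -/
inductive Adm (F₀ : ℝ) : (ℕ → ℝ) → Prop
  | leaf (p : ℕ) (ψ : ℕ → ℝ) (h0 : ∀ n, 0 ≤ ψ n) (h : ∀ n, ψ n ≤ if n = p then 1 else 0) :
      Adm F₀ ψ
  | node (m : ℕ) (hm : 2 ≤ m) (A : Set ℕ) (sel : ℕ → Fin m) (hsel : MonotoneOn sel A)
      (χ : Fin m → ℕ → ℝ) (hχ : ∀ j, Adm F₀ (χ j)) (ψ : ℕ → ℝ) (h0 : ∀ n, 0 ≤ ψ n)
      (hA : ∀ n ∈ A, ψ n ≤ 1 / f m * χ (sel n) n) (hA' : ∀ n ∉ A, ψ n = 0) : Adm F₀ ψ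
  | attach (m : ℕ) (hm : 2 ≤ m) (hF : F₀ ≤ f m) (p : ℕ) (A : Set ℕ) (sel : ℕ → Fin m)
      (hsel : MonotoneOn sel A)
      (χ : Fin m → ℕ → ℝ) (hχ : ∀ j, Adm F₀ (χ j)) (ψ : ℕ → ℝ) (h0 : ∀ n, 0 ≤ ψ n) (hp : ψ p ≤ 1)
      (hA : ∀ n ∈ A, n ≠ p → ψ n ≤ 1 / f m * χ (sel n) n) (hA' : ∀ n ∉ A, n ≠ p → ψ n = 0) :
      Adm F₀ ψ

theorem Adm.nonneg {F₀ : ℝ} {ψ : ℕ → ℝ} (h : Adm F₀ ψ) (n : ℕ) : 0 ≤ ψ n := by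
  cases h <;> solve_by_elim

theorem Adm.le_one {F₀ : ℝ} {ψ : ℕ → ℝ} (h : Adm F₀ ψ) (n : ℕ) : ψ n ≤ 1 := by
  induction h with
  | leaf p ψ h0 h => exact (h n).trans (by split_ifs <;> norm_num)
  | node m hm A sel hsel χ hχ ψ h0 hA hA' ih =>
    by_cases hn : n ∈ A
    · exact (hA n hn).trans (inv_f_mul_le hm ((hχ _).nonneg n) (ih _))
    · rw [hA' n hn]; exact zero_le_one
  | attach m hm hF p A sel hsel χ hχ ψ h0 hp hA hA' ih =>
    by_cases hnp : n = p
    · rwa [hnp]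
    by_cases hn : n ∈ A
    · exact (hA n hn hnp).trans (inv_f_mul_le hm ((hχ _).nonneg n) (ih _))
    · rw [hA' n hn hnp]; exact zero_le_one

/-- The action of a nonnegative sequence on the absolute value of a vector. -/
noncomputable def absPair (ψ : ℕ → ℝ) (u : ℕ →₀ ℝ) : ℝ := ∑ n ∈ u.support, ψ n * |u n|

theorem absPair_eq_sum {ψ : ℕ → ℝ} {u : ℕ →₀ ℝ} {s : Finset ℕ} (h : u.support ⊆ s) :
    absPair ψ u = ∑ n ∈ s, ψ n * |u n| :=
  Finset.sum_subset h fun n _ hn => by simp [Finsupp.notMem_support_iff.1 hn]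

theorem absPair_proj (ψ : ℕ → ℝ) (u : ℕ →₀ ℝ) (E : Finset ℕ) :
    absPair ψ (proj E u) = ∑ n ∈ u.support, if n ∈ E then ψ n * |u n| else 0 := by
  rw [absPair_eq_sum (s := u.support)]
  · refine Finset.sum_congr rfl fun n _ => ?_
    rw [proj_apply]
    split_ifs <;> simp
  · rw [proj, Finsupp.support_filter]
    exact Finset.filter_subset _ _

/-- The bound on the unattached part of a node of size `m` in terms of `F = f m`. -/
noncomputable def nodeBound (F : ℝ) : ℝ := 4 + 240 / √F

theorem nodeBound_anti {a b : ℝ} (ha : 0 < a) (h : a ≤ b) : nodeBound b ≤ nodeBound a := by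
  unfold nodeBound
  have := Real.sqrt_pos.2 ha
  gcongr

/-- The structure of an admissible sequence: up to one coordinate functional it is a node whose
children are bounded by `6`. -/
def HasNode (F₀ : ℝ) (ψ : ℕ → ℝ) : Prop :=
  ∃ (p : ℕ) (ψ' : ℕ → ℝ) (m : ℕ), 2 ≤ m ∧ (∀ n, 0 ≤ ψ' n) ∧
    (∀ n, ψ n ≤ if n = p then 1 else ψ' n) ∧
    (∀ u : ℕ →₀ ℝ, ∃ L : List (Finset ℕ), L.Pairwise Before ∧ (∀ E ∈ L, E ⊆ u.support) ∧
      L.length ≤ m ∧ absPair ψ' u ≤ 6 / f m * (L.map fun E => sNorm (proj E u)).sum) ∧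
    (F₀ ≤ f m → ∀ u : ℕ →₀ ℝ, absPair ψ' u ≤ nodeBound (f m) * sNorm u)

/-- This is where the `4` in `nodeBound` comes from: a child bounded by `6` below a node of any size
costs at most `6 / (3 / 2) = 4`. -/
theorem three_halves_le_f {m : ℕ} (hm : 2 ≤ m) : 3 / 2 ≤ f m := by
  refine le_trans ?_ (f_mono hm)
  have h : (2 : ℝ) * (3 / 2) = Real.logb 2 ((2 : ℝ) ^ (3 : ℕ)) := by
    rw [Real.logb_pow, Real.logb_self_eq_one (by norm_num)]; norm_num
  have h2 : Real.logb 2 ((2 : ℝ) ^ (3 : ℕ)) ≤ Real.logb 2 ((3 : ℝ) ^ (2 : ℕ)) :=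
    Real.logb_le_logb_of_le (by norm_num) (by norm_num) (by norm_num)
  rw [Real.logb_pow (b := 2) (x := 3), ← h] at h2
  unfold f
  push_cast at h2 ⊢
  norm_num at h2 ⊢
  linarith

theorem two_rpow_f (m : ℕ) : (2 : ℝ) ^ f m = m + 1 :=
  Real.rpow_logb (by norm_num) (by norm_num) (by positivity)

theorem f_le_of_le {N : ℕ} {t : ℝ} (h : (N : ℝ) + 1 ≤ 2 ^ t) : f N ≤ t := by
  unfold f
  rwa [Real.logb_le_iff_le_rpow (by norm_num) (by positivity)]

theorem proj_proj_of_subset {E G : Finset ℕ} (h : E ⊆ G) (u : ℕ →₀ ℝ) :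
    proj E (proj G u) = proj E u := by
  rw [proj_proj, Finset.inter_eq_left.2 h]

theorem support_proj_subset (E : Finset ℕ) (u : ℕ →₀ ℝ) :
    (proj E u).support ⊆ E ∩ u.support := by
  classical
  rw [proj, Finsupp.support_filter]
  intro i hi
  rw [Finset.mem_filter] at hi
  exact Finset.mem_inter.2 ⟨hi.2, hi.1⟩

theorem abs_le_sNorm_proj {E : Finset ℕ} {p : ℕ} (hp : p ∈ E) (u : ℕ →₀ ℝ) :
    |u p| ≤ sNorm (proj E u) := by
  have := abs_le_sNorm (proj E u) p
  rwa [proj_apply, if_pos hp] at this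

theorem Before.mono {A B A' B' : Finset ℕ} (h : Before A B) (hA : A' ⊆ A) (hB : B' ⊆ B) :
    Before A' B' := fun a ha b hb => h a (hA ha) b (hB hb)

theorem map_sum_nonneg (L : List (Finset ℕ)) (u : ℕ →₀ ℝ) :
    0 ≤ (L.map fun E => sNorm (proj E u)).sum :=
  List.sum_nonneg fun r hr => by
    obtain ⟨E, _, rfl⟩ := List.mem_map.1 hr
    exact sNorm_nonneg _

theorem map_sum_congr {L : List (Finset ℕ)} {G : Finset ℕ} (h : ∀ E ∈ L, E ⊆ G) (u : ℕ →₀ ℝ) :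
    (L.map fun E => sNorm (proj E (proj G u))).sum = (L.map fun E => sNorm (proj E u)).sum := by
  congr 1
  exact List.map_congr_left fun E hE => by rw [proj_proj_of_subset (h E hE)]

/-- Splitting the action of a child of a large node into pieces which are added to that node,
and pieces for which a large factor was gained. -/
theorem HasNode.split {ψ : ℕ → ℝ} (h : HasNode 57600 ψ) {F : ℝ} (hF : 57600 ≤ F) (v : ℕ →₀ ℝ) :
    ∃ L₁ L₂ : List (Finset ℕ), L₁.Pairwise Before ∧ L₂.Pairwise Before ∧
      (∀ E ∈ L₁, E ⊆ v.support) ∧ (∀ E ∈ L₂, E ⊆ v.support) ∧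
      (L₁.length : ℝ) ≤ 2 * 2 ^ √F ∧ (L₂.length : ℝ) ≤ 2 * 2 ^ (4 * F) ∧
      absPair ψ v ≤ nodeBound (4 * F) * (L₁.map fun E => sNorm (proj E v)).sum +
        6 / √F * (L₂.map fun E => sNorm (proj E v)).sum := by
  classical
  obtain ⟨p, ψ', m, hm, h0, hψ, hL, hD⟩ := h
  have hF0 : 0 < F := by linarith
  have hs : 240 ≤ √F := Real.le_sqrt_of_sq_le (by linarith)
  -- The exceptional coordinate `p` is isolated as its own piece, and the two sides are decomposed
  -- separately, so that no piece straddles `p`.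
  set A := v.support.filter (· < p) with hA
  set B := v.support.filter (p < ·) with hB
  set P := ({p} : Finset ℕ) ∩ v.support with hP
  have hAs : A ⊆ v.support := Finset.filter_subset _ _
  have hBs : B ⊆ v.support := Finset.filter_subset _ _
  have hPs : P ⊆ v.support := Finset.inter_subset_right
  have hAP : Before A P := by
    intro a ha b hb
    rw [hP, Finset.mem_inter, Finset.mem_singleton] at hb
    rw [hb.1]; exact (Finset.mem_filter.1 ha).2
  have hPB : Before P B := by
    intro a ha b hb
    rw [hP, Finset.mem_inter, Finset.mem_singleton] at ha
    rw [ha.1]; exact (Finset.mem_filter.1 hb).2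
  have hAB : Before A B := fun a ha b hb =>
    (Finset.mem_filter.1 ha).2.trans (Finset.mem_filter.1 hb).2
  have hK : (4 : ℝ) ≤ nodeBound (4 * F) := by
    unfold nodeBound
    have : 0 ≤ 240 / √(4 * F) := by positivity
    linarith
  have hsplit : absPair ψ v ≤
      sNorm (proj P v) + (absPair ψ' (proj A v) + absPair ψ' (proj B v)) := by
    have hp : |v p| ≤ sNorm (proj P v) := by
      by_cases hpv : p ∈ v.support
      · exact abs_le_sNorm_proj (by simpa [hP] using hpv) v
      · rw [Finsupp.notMem_support_iff.1 hpv, abs_zero]; exact sNorm_nonneg _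
    refine le_trans ?_ (add_le_add_left hp _)
    have h1 : |v p| = ∑ n ∈ v.support, if n = p then |v n| else 0 := by
      by_cases hpv : p ∈ v.support
      · rw [Finset.sum_ite_eq_of_mem' _ _ _ hpv]
      · rw [Finset.sum_eq_zero, Finsupp.notMem_support_iff.1 hpv, abs_zero]
        intro n hn
        rw [if_neg (ne_of_mem_of_not_mem hn hpv)]
    rw [absPair_proj, absPair_proj, h1, ← Finset.sum_add_distrib, ← Finset.sum_add_distrib]
    refine Finset.sum_le_sum fun n hn => ?_
    have hb := mul_le_mul_of_nonneg_right (hψ n) (abs_nonneg (v n))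
    rcases lt_trichotomy n p with hlt | heq | hgt
    · have hnA : n ∈ A := Finset.mem_filter.2 ⟨hn, hlt⟩
      have hnB : n ∉ B := fun h' => lt_asymm hlt (Finset.mem_filter.1 h').2
      simp only [hlt.ne, if_false, hnA, if_true, hnB] at hb ⊢
      linarith
    · have hnA : n ∉ A := fun h' => (Finset.mem_filter.1 h').2.ne heq
      have hnB : n ∉ B := fun h' => (Finset.mem_filter.1 h').2.ne' heq
      simp only [heq, if_true] at hb ⊢
      rw [heq] at hnA hnB
      simp only [hnA, hnB, if_false]
      linarith
    · have hnB : n ∈ B := Finset.mem_filter.2 ⟨hn, hgt⟩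
      have hnA : n ∉ A := fun h' => lt_asymm hgt (Finset.mem_filter.1 h').2
      simp only [hgt.ne', if_false, hnA, if_true, hnB] at hb ⊢
      linarith
  obtain ⟨LA, hA1, hA2, hA3, hA4⟩ := hL (proj A v)
  obtain ⟨LB, hB1, hB2, hB3, hB4⟩ := hL (proj B v)
  have hA2' : ∀ E ∈ LA, E ⊆ A := fun E hE =>
    (hA2 E hE).trans ((support_proj_subset A v).trans Finset.inter_subset_left)
  have hB2' : ∀ E ∈ LB, E ⊆ B := fun E hE =>
    (hB2 E hE).trans ((support_proj_subset B v).trans Finset.inter_subset_left)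
  rw [map_sum_congr hA2'] at hA4
  rw [map_sum_congr hB2'] at hB4
  have hSA := map_sum_nonneg LA v
  have hSB := map_sum_nonneg LB v
  set SA := (LA.map fun E => sNorm (proj E v)).sum with hSAdef
  set SB := (LB.map fun E => sNorm (proj E v)).sum with hSBdef
  have hSP := sNorm_nonneg (proj P v)
  have hfm := three_halves_le_f hm
  have hlenA : (LA.length : ℝ) ≤ m := by exact_mod_cast hA3
  have hlenB : (LB.length : ℝ) ≤ m := by exact_mod_cast hB3
  have hrpow2 : (2 : ℝ) ≤ 2 ^ √F := by
    calc (2 : ℝ) = 2 ^ (1 : ℝ) := by norm_num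
      _ ≤ _ := Real.rpow_le_rpow_of_exponent_le (by norm_num) (by linarith)
  by_cases hsmall : f m ≤ √F
  -- Small child: its own pieces are few enough to be handed directly to the parent.
  · refine ⟨LA ++ P :: LB, [], ?_, List.Pairwise.nil, ?_, by simp, ?_, ?_, ?_⟩
    · rw [List.pairwise_append, List.pairwise_cons]
      refine ⟨hA1, ⟨fun E hE => hPB.mono subset_rfl (hB2' E hE), hB1⟩, fun E hE G hG => ?_⟩
      rcases List.mem_cons.1 hG with rfl | hG
      · exact hAP.mono (hA2' E hE) subset_rfl
      · exact hAB.mono (hA2' E hE) (hB2' G hG)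
    · intro E hE
      rcases List.mem_append.1 hE with hE | hE
      · exact (hA2' E hE).trans hAs
      · rcases List.mem_cons.1 hE with rfl | hE
        · exact hPs
        · exact (hB2' E hE).trans hBs
    · have h1 : (m : ℝ) + 1 ≤ 2 ^ √F := two_rpow_f m ▸
        Real.rpow_le_rpow_of_exponent_le (by norm_num) hsmall
      simp only [List.length_append, List.length_cons]
      push_cast
      linarith
    · simp only [List.length_nil, Nat.cast_zero]; positivity
    · simp only [List.map_append, List.map_cons, List.sum_append, List.sum_cons, List.map_nil,
        List.sum_nil, mul_zero, add_zero]
      rw [← hSAdef, ← hSBdef]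
      have h6 : 6 / f m ≤ nodeBound (4 * F) := by
        refine le_trans ?_ hK
        rw [div_le_iff₀ (by linarith)]; linarith
      have e1 := mul_le_mul_of_nonneg_right h6 hSA
      have e2 := mul_le_mul_of_nonneg_right h6 hSB
      nlinarith
  push Not at hsmall
  by_cases hmid : f m ≤ 4 * F
  -- Intermediate child: there are many pieces, but its weight supplies the factor `6 / √F`.
  · refine ⟨[P], LA ++ LB, List.pairwise_singleton _ _, ?_, ?_, ?_, ?_, ?_, ?_⟩
    · rw [List.pairwise_append]
      exact ⟨hA1, hB1, fun E hE G hG => hAB.mono (hA2' E hE) (hB2' G hG)⟩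
    · intro E hE
      rw [List.mem_singleton.1 hE]
      exact hPs
    · intro E hE
      rcases List.mem_append.1 hE with hE | hE
      · exact (hA2' E hE).trans hAs
      · exact (hB2' E hE).trans hBs
    · simp only [List.length_singleton, Nat.cast_one]; linarith
    · have h1 : (m : ℝ) + 1 ≤ 2 ^ (4 * F) := two_rpow_f m ▸
        Real.rpow_le_rpow_of_exponent_le (by norm_num) hmid
      rw [List.length_append]
      push_cast
      linarith
    · simp only [List.map_append, List.map_cons, List.sum_append, List.sum_cons, List.map_nil,
        List.sum_nil, add_zero]
      rw [← hSAdef, ← hSBdef]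
      have h6 : 6 / f m ≤ 6 / √F :=
        div_le_div_of_nonneg_left (by norm_num) (by linarith) hsmall.le
      have e1 := mul_le_mul_of_nonneg_right h6 hSA
      have e2 := mul_le_mul_of_nonneg_right h6 hSB
      nlinarith
  · push Not at hmid
    have hD' := hD (by linarith)
    -- Very large child: its own node bound applies on each side of `p`, so three pieces suffice.
    refine ⟨[A, P, B], [], ?_, List.Pairwise.nil, ?_, by simp, ?_, ?_, ?_⟩
    · simp only [List.pairwise_cons, List.mem_cons, List.not_mem_nil, or_false, forall_eq_or_imp,
        forall_eq]
      exact ⟨⟨hAP, hAB⟩, hPB, by simp⟩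
    · intro E hE
      simp only [List.mem_cons, List.not_mem_nil, or_false] at hE
      rcases hE with rfl | rfl | rfl <;> assumption
    · simp only [List.length_cons, List.length_nil]
      norm_num
      linarith
    · simp only [List.length_nil, Nat.cast_zero]; positivity
    · simp only [List.map_cons, List.sum_cons, List.map_nil, List.sum_nil, mul_zero, add_zero]
      have hb : nodeBound (f m) ≤ nodeBound (4 * F) := nodeBound_anti (by linarith) hmid.le
      have e1 := (hD' (proj A v)).trans (mul_le_mul_of_nonneg_right hb (sNorm_nonneg _))
      have e2 := (hD' (proj B v)).trans (mul_le_mul_of_nonneg_right hb (sNorm_nonneg _))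
      nlinarith

theorem pairwise_flatten_ofFn {m : ℕ} {G : Fin m → Finset ℕ} (hG : ∀ i j, i < j → Before (G i) (G j))
    {L : Fin m → List (Finset ℕ)} (hL : ∀ j, (L j).Pairwise Before)
    (hLG : ∀ j, ∀ E ∈ L j, E ⊆ G j) : (List.ofFn L).flatten.Pairwise Before := by
  rw [List.pairwise_flatten, List.pairwise_ofFn]
  refine ⟨fun l hl => ?_, fun i j hij A hA B hB => (hG i j hij).mono (hLG i A hA) (hLG j B hB)⟩
  obtain ⟨j, rfl⟩ := (List.mem_ofFn' _ _).1 hl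
  exact hL j

theorem sum_flatten_ofFn {m : ℕ} (L : Fin m → List (Finset ℕ)) (g : Finset ℕ → ℝ) :
    ((List.ofFn L).flatten.map g).sum = ∑ j, ((L j).map g).sum := by
  rw [List.map_flatten, List.sum_flatten, List.map_map, List.map_ofFn, List.sum_ofFn]
  rfl

theorem length_flatten_ofFn_le {m : ℕ} (L : Fin m → List (Finset ℕ)) {b : ℝ}
    (h : ∀ j, ((L j).length : ℝ) ≤ b) : (((List.ofFn L).flatten.length : ℕ) : ℝ) ≤ m * b := by
  rw [List.length_flatten, List.map_ofFn, List.sum_ofFn]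
  push_cast
  calc _ ≤ ∑ _j : Fin m, b := Finset.sum_le_sum fun j _ => h j
    _ = m * b := by simp

/-- The set of support points of `u` which a node assigns to its child `j`. -/
noncomputable def fiber {m : ℕ} (A : Set ℕ) (sel : ℕ → Fin m) (u : ℕ →₀ ℝ) (j : Fin m) :
    Finset ℕ := by
  classical exact u.support.filter fun n => n ∈ A ∧ sel n = j

theorem mem_fiber {m : ℕ} {A : Set ℕ} {sel : ℕ → Fin m} {u : ℕ →₀ ℝ} {j : Fin m} {n : ℕ} :
    n ∈ fiber A sel u j ↔ n ∈ u.support ∧ n ∈ A ∧ sel n = j := by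
  classical
  unfold fiber
  rw [Finset.mem_filter]

theorem before_fiber {m : ℕ} {A : Set ℕ} {sel : ℕ → Fin m} (hsel : MonotoneOn sel A)
    (u : ℕ →₀ ℝ) (i j : Fin m) (hij : i < j) : Before (fiber A sel u i) (fiber A sel u j) := by
  intro a ha b hb
  obtain ⟨_, ha1, rfl⟩ := mem_fiber.1 ha
  obtain ⟨_, hb1, rfl⟩ := mem_fiber.1 hb
  by_contra! hba
  exact absurd (hsel hb1 ha1 hba) (not_le.2 hij)

/-- Each support point is charged to the single child that `sel` assigns to it. -/
theorem absPair_node_le {m : ℕ} {A : Set ℕ} {sel : ℕ → Fin m}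
    {χ : Fin m → ℕ → ℝ} {ψ : ℕ → ℝ}
    (hA : ∀ n ∈ A, ψ n ≤ 1 / f m * χ (sel n) n) (hA' : ∀ n ∉ A, ψ n = 0) (u : ℕ →₀ ℝ) :
    absPair ψ u ≤ 1 / f m * ∑ j, absPair (χ j) (proj (fiber A sel u j) u) := by
  simp only [absPair_proj]
  rw [Finset.sum_comm, Finset.mul_sum]
  refine Finset.sum_le_sum fun n hn => ?_
  by_cases h : n ∈ A
  · rw [Finset.sum_eq_single (sel n), if_pos (mem_fiber.2 ⟨hn, h, rfl⟩), ← mul_assoc]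
    · exact mul_le_mul_of_nonneg_right (hA n h) (abs_nonneg _)
    · intro j _ hj
      rw [if_neg fun h' => hj (mem_fiber.1 h').2.2.symm]
    · simp
  · rw [hA' n h, zero_mul, Finset.sum_eq_zero fun j _ => if_neg fun h' => h (mem_fiber.1 h').2.1,
      mul_zero]

theorem fiber_subset {m : ℕ} (A : Set ℕ) (sel : ℕ → Fin m) (u : ℕ →₀ ℝ) (j : Fin m) :
    fiber A sel u j ⊆ u.support := fun _ h => (mem_fiber.1 h).1

theorem absPair_node_le_list {m : ℕ} (hm : 2 ≤ m) {A : Set ℕ} {sel : ℕ → Fin m}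
    (hsel : MonotoneOn sel A) {χ : Fin m → ℕ → ℝ} {ψ : ℕ → ℝ}
    (hA : ∀ n ∈ A, ψ n ≤ 1 / f m * χ (sel n) n) (hA' : ∀ n ∉ A, ψ n = 0)
    (h6 : ∀ j u, absPair (χ j) u ≤ 6 * sNorm u) (u : ℕ →₀ ℝ) :
    ∃ L : List (Finset ℕ), L.Pairwise Before ∧ (∀ E ∈ L, E ⊆ u.support) ∧
      L.length ≤ m ∧ absPair ψ u ≤ 6 / f m * (L.map fun E => sNorm (proj E u)).sum := by
  refine ⟨List.ofFn (fiber A sel u), ?_, ?_, (List.length_ofFn).le, ?_⟩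
  · rw [List.pairwise_ofFn]
    exact fun i j hij => before_fiber hsel u i j hij
  · intro E hE
    obtain ⟨j, rfl⟩ := (List.mem_ofFn' _ _).1 hE
    exact fiber_subset A sel u j
  · refine (absPair_node_le hA hA' u).trans ?_
    rw [List.map_ofFn, List.sum_ofFn]
    refine (mul_le_mul_of_nonneg_left (Finset.sum_le_sum fun j _ => h6 j _)
      (inv_f_nonneg hm)).trans (le_of_eq ?_)
    rw [← Finset.mul_sum, ← mul_assoc, one_div_mul_eq_div]
    rfl

/-- The self-improving estimate. Each child is split by `HasNode.split`, and the pieces of all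
children are summed at once by the implicit equation, so the number of pieces enters only through
its logarithm. The constant in `nodeBound` is chosen to reproduce itself. -/
theorem absPair_node_le_nodeBound {m : ℕ} (hm : 2 ≤ m) {A : Set ℕ} {sel : ℕ → Fin m}
    (hsel : MonotoneOn sel A) {χ : Fin m → ℕ → ℝ} {ψ : ℕ → ℝ}
    (hA : ∀ n ∈ A, ψ n ≤ 1 / f m * χ (sel n) n) (hA' : ∀ n ∉ A, ψ n = 0)
    (hχ : ∀ j, HasNode 57600 (χ j)) (hF : 57600 ≤ f m) (u : ℕ →₀ ℝ) :
    absPair ψ u ≤ nodeBound (f m) * sNorm u := by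
  set F := f m with hFdef
  have hF0 : 0 < F := by linarith
  have hs : 240 ≤ √F := Real.le_sqrt_of_sq_le (by linarith)
  choose L₁ L₂ h1 h2 h3 h4 h5 h6 h7 using
    fun j => (hχ j).split hF (proj (fiber A sel u j) u)
  have hsub : ∀ j, (proj (fiber A sel u j) u).support ⊆ fiber A sel u j := fun j =>
    (support_proj_subset _ _).trans Finset.inter_subset_left
  have h3' : ∀ j, ∀ E ∈ L₁ j, E ⊆ fiber A sel u j := fun j E hE => (h3 j E hE).trans (hsub j)
  have h4' : ∀ j, ∀ E ∈ L₂ j, E ⊆ fiber A sel u j := fun j E hE => (h4 j E hE).trans (hsub j)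
  have hm1 : (m : ℝ) + 1 = 2 ^ F := (two_rpow_f m).symm
  -- With `m + 1 = 2 ^ F`, having `2 * 2 ^ t` pieces per child gives `f ≤ F + 1 + t` for the total.
  have hlen : ∀ (L : Fin m → List (Finset ℕ)) (t : ℝ), 0 ≤ t →
      (∀ j, ((L j).length : ℝ) ≤ 2 * 2 ^ t) → f (List.ofFn L).flatten.length ≤ F + 1 + t := by
    intro L t ht hL
    refine f_le_of_le ?_
    have h := length_flatten_ofFn_le L hL
    rw [Real.rpow_add (by norm_num), Real.rpow_add (by norm_num), Real.rpow_one, ← hm1]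
    have : (1 : ℝ) ≤ 2 ^ t := Real.one_le_rpow (by norm_num) ht
    nlinarith
  have hsum1 := list_sum_sNorm_proj_le
    (pairwise_flatten_ofFn (before_fiber hsel u) h1 h3') (hlen L₁ (√F) (by positivity) h5) u
  have hsum2 := list_sum_sNorm_proj_le
    (pairwise_flatten_ofFn (before_fiber hsel u) h2 h4') (hlen L₂ (4 * F) (by positivity) h6) u
  rw [sum_flatten_ofFn] at hsum1 hsum2
  -- Passing from `F` to `4F` halves the error; this pays for the other terms.
  have hK : nodeBound (4 * F) = 4 + 120 / √F := by
    unfold nodeBound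
    rw [Real.sqrt_mul (by norm_num), show √4 = 2 by
      rw [show (4 : ℝ) = 2 ^ 2 by norm_num]; exact Real.sqrt_sq (by norm_num)]
    field_simp
    ring
  have hmain : ∑ j, absPair (χ j) (proj (fiber A sel u j) u) ≤
      nodeBound (4 * F) * ((F + 1 + √F) * sNorm u) +
        6 / √F * ((F + 1 + 4 * F) * sNorm u) := by
    have hK0 : 0 ≤ nodeBound (4 * F) := by rw [hK]; positivity
    refine le_trans ?_ (add_le_add (mul_le_mul_of_nonneg_left hsum1 hK0)
      (mul_le_mul_of_nonneg_left hsum2 (by positivity)))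
    rw [Finset.mul_sum, Finset.mul_sum, ← Finset.sum_add_distrib]
    refine Finset.sum_le_sum fun j _ => ?_
    have := h7 j
    rwa [map_sum_congr (h3' j), map_sum_congr (h4' j)] at this
  refine (absPair_node_le hA hA' u).trans ((mul_le_mul_of_nonneg_left hmain
    (inv_f_nonneg hm)).trans ?_)
  rw [← hFdef, hK]
  unfold nodeBound
  obtain ⟨t, ht⟩ : ∃ t, t = √F := ⟨_, rfl⟩
  have htF : F = t ^ 2 := by rw [ht, Real.sq_sqrt hF0.le]
  rw [← ht] at hs ⊢
  rw [htF]
  have key : 1 / t ^ 2 * ((4 + 120 / t) * (t ^ 2 + 1 + t) + 6 / t * (t ^ 2 + 1 + 4 * t ^ 2)) ≤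
      4 + 240 / t := by
    have ht0 : 0 < t := by linarith
    have e : 4 + 240 / t -
        1 / t ^ 2 * ((4 + 120 / t) * (t ^ 2 + 1 + t) + 6 / t * (t ^ 2 + 1 + 4 * t ^ 2)) =
        (86 * t ^ 2 - 124 * t - 126) / t ^ 3 := by
      field_simp
      ring
    have : 0 ≤ (86 * t ^ 2 - 124 * t - 126) / t ^ 3 := div_nonneg (by nlinarith) (by positivity)
    linarith
  calc _ = 1 / t ^ 2 * ((4 + 120 / t) * (t ^ 2 + 1 + t) + 6 / t * (t ^ 2 + 1 + 4 * t ^ 2)) *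
        sNorm u := by ring
    _ ≤ _ := mul_le_mul_of_nonneg_right key (sNorm_nonneg u)

/-- The two conclusions need each other: the node bound of a parent uses the structure of its
children, while the list estimate in that structure uses the bound `6` for the children. -/
theorem Adm.bound_and_hasNode {ψ : ℕ → ℝ} (h : Adm 57600 ψ) :
    (∀ u, absPair ψ u ≤ 6 * sNorm u) ∧ HasNode 57600 ψ := by
  -- Both kinds of node are treated together by zeroing the coordinate `p`, which leaves an ordinary
  -- node.
  have attached : ∀ (m : ℕ), 2 ≤ m → ∀ (p : ℕ) (A : Set ℕ) (sel : ℕ → Fin m), MonotoneOn sel A →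
      ∀ χ : Fin m → ℕ → ℝ,
      (∀ j, (∀ u, absPair (χ j) u ≤ 6 * sNorm u) ∧ HasNode 57600 (χ j)) →
      (∀ j n, 0 ≤ χ j n) →
      ∀ ψ : ℕ → ℝ, (∀ n, 0 ≤ ψ n) → ψ p ≤ 1 →
      (∀ n ∈ A, n ≠ p → ψ n ≤ 1 / f m * χ (sel n) n) → (∀ n ∉ A, n ≠ p → ψ n = 0) →
      ((57600 ≤ f m → ∀ u, absPair ψ u ≤ 6 * sNorm u) ∧ HasNode 57600 ψ) := by
    intro m hm p A sel hsel χ hχ hχ0 ψ h0 hp hA hA'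
    set ψ' : ℕ → ℝ := fun n => if n = p then 0 else ψ n with hψ'
    have e0 : ∀ n, 0 ≤ ψ' n := fun n => by
      simp only [hψ']; split_ifs; exacts [le_rfl, h0 n]
    have e1 : ∀ n ∈ A, ψ' n ≤ 1 / f m * χ (sel n) n := fun n hn => by
      simp only [hψ']
      split_ifs with h
      · exact mul_nonneg (inv_f_nonneg hm) (hχ0 _ _)
      · exact hA n hn h
    have e2 : ∀ n ∉ A, ψ' n = 0 := fun n hn => by
      simp only [hψ']
      split_ifs with h
      exacts [rfl, hA' n hn h]
    have e3 : ∀ n, ψ n ≤ if n = p then 1 else ψ' n := fun n => by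
      simp only [hψ']
      split_ifs with h
      exacts [h ▸ hp, le_rfl]
    have e4 := fun hF => absPair_node_le_nodeBound hm hsel e1 e2 (fun j => (hχ j).2) hF
    refine ⟨fun hF u => ?_, p, ψ', m, hm, e0, e3, ?_, e4⟩
    · have h1 : absPair ψ u ≤ |u p| + absPair ψ' u := by
        have h1 : ∑ n ∈ u.support, (if n = p then |u n| else 0) ≤ |u p| := by
          rw [Finset.sum_ite_eq']
          split_ifs
          exacts [le_rfl, abs_nonneg _]
        refine le_trans ?_ (add_le_add_left h1 _)
        unfold absPair
        rw [← Finset.sum_add_distrib]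
        refine Finset.sum_le_sum fun n _ => ?_
        have h2 := mul_le_mul_of_nonneg_right (e3 n) (abs_nonneg (u n))
        have h3 := mul_nonneg (e0 n) (abs_nonneg (u n))
        split_ifs at h2 ⊢ <;> linarith
      -- Since `57600 = 240 ^ 2`, the node part costs at most `4 + 1`, and the attached coordinate
      -- costs `1` more: this is the constant `6`.
      have hs : 240 ≤ √(f m) := Real.le_sqrt_of_sq_le (by linarith)
      have h5 : nodeBound (f m) ≤ 5 := by
        unfold nodeBound
        have : 240 / √(f m) ≤ 1 := by rwa [div_le_one (by linarith)]
        linarith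
      have h6 := (e4 hF u).trans (mul_le_mul_of_nonneg_right h5 (sNorm_nonneg u))
      linarith [abs_le_sNorm u p]
    · exact absPair_node_le_list hm hsel e1 e2 fun j => (hχ j).1
  induction h with
  | leaf p ψ h0 h =>
    have hn : ∀ n, n ≠ p → ψ n = 0 := fun n hn => le_antisymm (by simpa [hn] using h n) (h0 n)
    -- A leaf is its exceptional coordinate alone; the zero node of size `2` is a dummy.
    refine ⟨fun u => ?_, p, 0, 2, le_rfl, fun n => le_rfl, h, fun u => ⟨[], ?_⟩, fun _ u => ?_⟩
    · have h1 : absPair ψ u ≤ |u p| := by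
        unfold absPair
        by_cases hp : p ∈ u.support
        · rw [Finset.sum_eq_single_of_mem p hp fun n _ h' => by rw [hn n h', zero_mul]]
          have := h p
          rw [if_pos rfl] at this
          nlinarith [abs_nonneg (u p)]
        · rw [Finset.sum_eq_zero]
          · exact abs_nonneg _
          · intro n h'
            rw [hn n (ne_of_mem_of_not_mem h' hp), zero_mul]
      linarith [abs_le_sNorm u p, sNorm_nonneg u]
    · simp [absPair]
    · have : 0 ≤ nodeBound (f 2) := by unfold nodeBound; positivity
      simpa [absPair] using mul_nonneg this (sNorm_nonneg u)
  | node m hm A sel hsel χ hχ ψ h0 hA hA' ih =>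
    have hψ : Adm 57600 ψ := .node m hm A sel hsel χ hχ ψ h0 hA hA'
    -- An ordinary node has no exceptional coordinate. Any index will do, here `0`, because all
    -- values are at most `1`.
    refine ⟨fun u => ?_, (attached m hm 0 A sel hsel χ ih (fun j => (hχ j).nonneg) ψ h0
      (hψ.le_one 0) (fun n hn _ => hA n hn) fun n hn _ => hA' n hn).2⟩
    have hs : Successive (fiber A sel u) := fun i j hij => before_fiber hsel u i j hij
    refine (absPair_node_le hA hA' u).trans ?_
    have h1 := (sNorm_solves u).1 (Or.inr ⟨m, hm, _, hs, rfl⟩)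
    calc _ ≤ 1 / f m * ∑ j, 6 * sNorm (proj (fiber A sel u j) u) :=
          mul_le_mul_of_nonneg_left (Finset.sum_le_sum fun j _ => (ih j).1 _) (inv_f_nonneg hm)
      _ ≤ _ := by rw [← Finset.mul_sum]; linarith
  | attach m hm hF p A sel hsel χ hχ ψ h0 hp hA hA' ih =>
    have := attached m hm p A sel hsel χ ih (fun j => (hχ j).nonneg) ψ h0 hp hA hA'
    exact ⟨this.1 hF, this.2⟩

/-! ### Tree functionals acting on rapidly increasing averages. -/

/-- The average of the first `k` terms of a sequence of vectors. -/
noncomputable def avg (X : ℕ → ℕ →₀ ℝ) (k : ℕ) : ℕ →₀ ℝ :=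
  (1 / (k : ℝ)) • ∑ i ∈ Finset.range k, X i

open Classical in
/-- The number of those among the first `k` vectors whose support meets `E`. -/
noncomputable def hits (X : ℕ → ℕ →₀ ℝ) (k : ℕ) (E : Finset ℕ) : ℕ :=
  ((Finset.range k).filter fun i => ∃ p ∈ E, X i p ≠ 0).card

theorem hits_le (X : ℕ → ℕ →₀ ℝ) (k : ℕ) (E : Finset ℕ) : hits X k E ≤ k := by
  classical
  exact (Finset.card_filter_le _ _).trans (Finset.card_range k).le

theorem hits_eq_zero {X : ℕ → ℕ →₀ ℝ} {k : ℕ} {E : Finset ℕ}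
    (h : ¬ ∃ i < k, ∃ p ∈ E, X i p ≠ 0) : hits X k E = 0 := by
  classical
  unfold hits
  rw [Finset.card_eq_zero, Finset.filter_eq_empty_iff]
  exact fun i hi h' => h ⟨i, Finset.mem_range.1 hi, h'⟩

/-- Apart from the last vector that each `G j` meets, no vector is counted for two different `j`;
this leaves an excess of at most one per set. -/
theorem sum_hits_le {X : ℕ → ℕ →₀ ℝ} {k : ℕ}
    (hX : ∀ i j, i < j → j < k → Before (X i).support (X j).support)
    {m : ℕ} {G : Fin m → Finset ℕ} (hG : Successive G) {E : Finset ℕ} (hE : ∀ j, G j ⊆ E) :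
    ∑ j, hits X k (G j) ≤ hits X k E + m := by
  classical
  set H : Finset ℕ → Finset ℕ := fun E => (Finset.range k).filter fun i => ∃ p ∈ E, X i p ≠ 0
    with hH
  -- The indices met by `G j` other than the last one. A later vector still meets `G j`, so no later
  -- set can reach back to these.
  set T : Fin m → Finset ℕ := fun j => (H (G j)).filter fun i => ∃ i' ∈ H (G j), i < i' with hT
  have h1 : ∀ j, (H (G j)).card ≤ (T j).card + 1 := by
    intro j
    have : (H (G j) \ T j).card ≤ 1 := by
      rw [Finset.card_le_one]
      intro a ha b hb
      simp only [hT, Finset.mem_sdiff, Finset.mem_filter, not_and, not_exists, not_lt] at ha hb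
      exact le_antisymm (hb.2 hb.1 a ha.1) (ha.2 ha.1 b hb.1)
    have h2 := Finset.card_sdiff_add_card_eq_card (show T j ⊆ H (G j) from Finset.filter_subset _ _)
    omega
  have hdisj : ∀ i j, i < j → Disjoint (T i) (T j) := by
    intro i j hij
    rw [Finset.disjoint_left]
    intro a ha hb
    simp only [hT, hH, Finset.mem_filter, Finset.mem_range] at ha hb
    obtain ⟨_, b, ⟨hbk, p, hp, hbp⟩, hab⟩ := ha
    obtain ⟨⟨_, q, hq, haq⟩, _⟩ := hb
    have h2 := hX a b hab hbk q (Finsupp.mem_support_iff.2 haq) p (Finsupp.mem_support_iff.2 hbp)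
    exact lt_asymm h2 (hG i j hij p hp q hq)
  have h2 : ∑ j, (T j).card ≤ (H E).card := by
    rw [← Finset.card_biUnion]
    · refine Finset.card_le_card (Finset.biUnion_subset.2 fun j _ i hi => ?_)
      simp only [hT, hH, Finset.mem_filter] at hi ⊢
      obtain ⟨⟨hik, p, hp, hip⟩, _⟩ := hi
      exact ⟨hik, p, hE j hp, hip⟩
    · intro i _ j _ hij
      rcases lt_or_gt_of_ne hij with h | h
      · exact hdisj i j h
      · exact (hdisj j i h).symm
  calc ∑ j, hits X k (G j) = ∑ j, (H (G j)).card := rfl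
    _ ≤ ∑ j, ((T j).card + 1) := Finset.sum_le_sum fun j _ => h1 j
    _ ≤ hits X k E + m := by
      rw [Finset.sum_add_distrib, Finset.sum_const, Finset.card_univ, Fintype.card_fin,
        smul_eq_mul, mul_one]
      exact Nat.add_le_add_right h2 m

theorem NormingOn.abs_pair_avg_le {E : Finset ℕ} {φ : ℕ → ℝ} (h : NormingOn E φ)
    {X : ℕ → ℕ →₀ ℝ} {k : ℕ} (hX : ∀ i, sNorm (X i) ≤ 1) :
    |pair φ (avg X k)| ≤ hits X k E / k := by
  classical
  rw [avg, map_smul, map_sum, smul_eq_mul, abs_mul, abs_of_nonneg (by positivity),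
    one_div_mul_eq_div]
  refine div_le_div_of_nonneg_right ?_ (by positivity)
  refine (Finset.abs_sum_le_sum_abs _ _).trans ?_
  have h1 : ∀ i ∈ Finset.range k, |pair φ (X i)| ≤ if ∃ p ∈ E, X i p ≠ 0 then 1 else 0 := by
    intro i _
    split_ifs with hi
    · exact (h.abs_pair_le _).trans (hX i)
    · have : proj E (X i) = 0 := by
        ext p
        rw [proj_apply]
        split_ifs with hp
        · by_contra h'
          exact hi ⟨p, hp, h'⟩
        · rfl
      rw [← h.pair_proj, this, map_zero, abs_zero]
  refine (Finset.sum_le_sum h1).trans ?_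
  rw [Finset.sum_boole]
  exact le_rfl

theorem sum_sum_le {m : ℕ} {G : Fin m → Finset ℕ} (hG : Successive G) {E : Finset ℕ}
    (hE : ∀ j, G j ⊆ E) (g : ℕ → ℝ) (hg : ∀ i, 0 ≤ g i) :
    ∑ j, ∑ p ∈ G j, g p ≤ ∑ p ∈ E, g p := by
  classical
  rw [← Finset.sum_biUnion]
  · exact Finset.sum_le_sum_of_subset_of_nonneg (Finset.biUnion_subset.2 fun j _ => hE j)
      fun i _ _ => hg i
  · intro i _ j _ hij
    rw [Function.onFun, Finset.disjoint_left]
    exact fun a ha hb => hij (hG.eq_of_mem ha hb)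

/-- The error accumulated by splitting an average along `d` levels of nodes of size below `M`. -/
noncomputable def depthErr (M : ℕ) : ℕ → ℝ
  | 0 => 0
  | d + 1 => M * (depthErr M d + 2)

theorem depthErr_nonneg (M d : ℕ) : 0 ≤ depthErr M d := by
  induction d with
  | zero => exact le_rfl
  | succ d ih => unfold depthErr; positivity

/-- A tree functional acts on a rapidly increasing sequence of averages like an admissible
sequence. -/
theorem NormingOn.exists_adm {F₀ : ℝ} {x : ℕ → ℕ → ℕ →₀ ℝ} {k M : ℕ → ℕ}
    (hM : StrictMono M) (hF : F₀ ≤ f (M 0)) (hx : ∀ n i, sNorm (x n i) ≤ 1)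
    (hin : ∀ n i j, i < j → j < k n → Before (x n i).support (x n j).support)
    (hout : ∀ n n' i i', n < n' → i < k n → i' < k n' →
      Before (x n i).support (x n' i').support)
    {E : Finset ℕ} {φ : ℕ → ℝ} (h : NormingOn E φ) :
    ∃ ψ, Adm F₀ ψ ∧ ∀ n d, |pair φ (avg (x n) (k n))| ≤
      (hits (x n) (k n) E / k n) * (ψ n + (1 / f 2) ^ d) + depthErr (M n) d / k n +
        (∑ p ∈ E, |avg (x n) (k n) p|) / f (M (n + 1)) := by
  classical
  have hq0 : 0 ≤ 1 / f 2 := inv_f_nonneg le_rfl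
  have hfM : ∀ n, 0 < f (M (n + 1)) := fun n => by
    have : 1 ≤ M (n + 1) := (Nat.zero_le _).trans_lt (hM (Nat.lt_succ_self n))
    linarith [one_le_f this]
  have herr : ∀ (E : Finset ℕ) n d, 0 ≤ depthErr (M n) d / k n +
      (∑ p ∈ E, |avg (x n) (k n) p|) / f (M (n + 1)) := fun E n d =>
    add_nonneg (div_nonneg (depthErr_nonneg _ _) (by positivity))
      (div_nonneg (Finset.sum_nonneg fun _ _ => abs_nonneg _) (hfM n).le)
  have triv : ∀ {E φ} (_ : NormingOn E φ) {ψ : ℕ → ℝ} {n d : ℕ}, 0 ≤ ψ n →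
      1 ≤ ψ n + (1 / f 2) ^ d → |pair φ (avg (x n) (k n))| ≤
      (hits (x n) (k n) E / k n) * (ψ n + (1 / f 2) ^ d) + depthErr (M n) d / k n +
        (∑ p ∈ E, |avg (x n) (k n) p|) / f (M (n + 1)) := by
    intro E φ h ψ n d h0 h1
    have h2 := h.abs_pair_avg_le (k := k n) (hx n)
    have h3 := herr E n d
    have h4 : (0 : ℝ) ≤ hits (x n) (k n) E / k n := by positivity
    nlinarith
  have hord : ∀ (n n' p q : ℕ), n < n' → (∃ i < k n, x n i p ≠ 0) → (∃ i < k n', x n' i q ≠ 0) →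
      p < q := by
    rintro n n' p q hn ⟨i, hi, hp⟩ ⟨i', hi', hq⟩
    exact hout n n' i i' hn hi hi' p (Finsupp.mem_support_iff.2 hp) q (Finsupp.mem_support_iff.2 hq)
  induction h with
  | zero E =>
    refine ⟨0, .leaf 0 0 (fun _ => le_rfl) fun n => by split_ifs <;> simp, fun n d => ?_⟩
    have := herr E n d
    have h0 : pair 0 (avg (x n) (k n)) = 0 := by simp [pair_apply]
    rw [h0, abs_zero, add_assoc]
    simp only [Pi.zero_apply]
    positivity
  | leaf E p s hp hs =>
    have hnorm : NormingOn E (Pi.single p s) := .leaf E p s hp hs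
    by_cases hn : ∃ n, ∃ i < k n, x n i p ≠ 0
    · obtain ⟨n₀, hn₀⟩ := hn
      refine ⟨fun n => if n = n₀ then 1 else 0,
        .leaf n₀ _ (fun n => by split_ifs <;> norm_num) fun n => le_rfl, fun n d => ?_⟩
      by_cases hnn : n = n₀
      · exact triv hnorm (ψ := fun n => if n = n₀ then 1 else 0) (by simp [hnn])
          (by simp only [hnn, if_true]; linarith [pow_nonneg hq0 d])
      · have : avg (x n) (k n) p = 0 := by
          have h0 : ∀ i < k n, x n i p = 0 := by
            intro i hi
            by_contra h'
            rcases lt_or_gt_of_ne hnn with h | h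
            · exact lt_irrefl _ (hord n n₀ p p h ⟨i, hi, h'⟩ hn₀)
            · exact lt_irrefl _ (hord n₀ n p p h hn₀ ⟨i, hi, h'⟩)
          rw [avg, Finsupp.smul_apply, Finsupp.finsetSum_apply,
            Finset.sum_eq_zero fun i hi => h0 i (Finset.mem_range.1 hi), smul_zero]
        have h2 := herr E n d
        rw [pair_single, this, zero_mul, abs_zero, add_assoc]
        simp only [hnn, if_false]
        positivity
    · push Not at hn
      refine ⟨0, .leaf 0 0 (fun _ => le_rfl) fun n => by split_ifs <;> simp, fun n d => ?_⟩
      have : avg (x n) (k n) p = 0 := by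
        rw [avg, Finsupp.smul_apply, Finsupp.finsetSum_apply,
          Finset.sum_eq_zero fun i hi => hn n i (Finset.mem_range.1 hi), smul_zero]
      have h2 := herr E n d
      rw [pair_single, this, zero_mul, abs_zero, add_assoc]
      simp only [Pi.zero_apply]
      positivity
  | node E m hm G hG hGE φ h ih =>
    choose χ hχ hbound using ih
    have hnorm : NormingOn E (fun n => 1 / f m * ∑ j, φ j n) := .node E m hm G hG hGE φ h
    set hit : ℕ → Fin m → Prop := fun n j => ∃ i < k n, ∃ p ∈ G j, x n i p ≠ 0 with hhit
    -- Several children may meet the same average. Since the proportions of hits nearly add up to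
    -- that of the parent, the average can be charged to the child with the largest `χ j n`.
    have hsel : ∀ n, ∃ s : Fin m, (∃ j, hit n j) → hit n s ∧ ∀ j, hit n j → χ j n ≤ χ s n := by
      intro n
      by_cases hn : ∃ j, hit n j
      · obtain ⟨j, hj⟩ := hn
        obtain ⟨s, hs, hmax⟩ := Finset.exists_max_image (Finset.univ.filter (hit n))
          (fun j => χ j n) ⟨j, by simpa using hj⟩
        exact ⟨s, fun _ => ⟨(Finset.mem_filter.1 hs).2, fun j hj => hmax j (by simpa using hj)⟩⟩
      · exact ⟨⟨0, by omega⟩, fun h => absurd h hn⟩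
    choose sel hsel1 using hsel
    set A : Set ℕ := {n | ∃ j, hit n j} with hA
    have hmono : MonotoneOn sel A := by
      intro n hn n' hn' hle
      rcases hle.eq_or_lt with rfl | hlt
      · exact le_rfl
      · by_contra! hs
        obtain ⟨i, hi, p, hp, hip⟩ := (hsel1 n hn).1
        obtain ⟨i', hi', q, hq, hiq⟩ := (hsel1 n' hn').1
        exact lt_asymm (hord n n' p q hlt ⟨i, hi, hip⟩ ⟨i', hi', hiq⟩)
          (hG _ _ hs q hq p hp)
    set base : ℕ → ℝ := fun n => if n ∈ A then 1 / f m * χ (sel n) n else 0 with hbase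
    have hbase0 : ∀ n, 0 ≤ base n := fun n => by
      simp only [hbase]
      split_ifs
      exacts [mul_nonneg (inv_f_nonneg hm) ((hχ _).nonneg n), le_rfl]
    have hfm : 0 < f m := by linarith [one_lt_f hm]
    have hfm2 : 1 / f m ≤ 1 / f 2 :=
      div_le_div_of_nonneg_left zero_le_one (by linarith [one_lt_f le_rfl]) (f_mono hm)
    have hpair : ∀ n, |pair (fun n => 1 / f m * ∑ j, φ j n) (avg (x n) (k n))| ≤
        1 / f m * ∑ j, |pair (φ j) (avg (x n) (k n))| := by
      intro n
      rw [pair_node, abs_mul, abs_of_nonneg (inv_f_nonneg hm)]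
      exact mul_le_mul_of_nonneg_left (Finset.abs_sum_le_sum_abs _ _) (inv_f_nonneg hm)
    have hl1 : ∀ n, ∑ j, ∑ p ∈ G j, |avg (x n) (k n) p| ≤ ∑ p ∈ E, |avg (x n) (k n) p| :=
      fun n => sum_sum_le hG hGE _ fun _ => abs_nonneg _
    -- All averages except the one whose size window contains `m`.
    have generic : ∀ n d, m < M n ∨ M (n + 1) ≤ m →
        |pair (fun n => 1 / f m * ∑ j, φ j n) (avg (x n) (k n))| ≤
        (hits (x n) (k n) E / k n) * (base n + (1 / f 2) ^ d) + depthErr (M n) d / k n +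
          (∑ p ∈ E, |avg (x n) (k n) p|) / f (M (n + 1)) := by
      intro n d hmn
      have hθ0 : (0 : ℝ) ≤ hits (x n) (k n) E / k n := by positivity
      have hqd : 0 ≤ (1 / f 2) ^ d := pow_nonneg hq0 d
      rcases hmn with hmn | hmn
      · cases d with
        -- At depth `0` the slack `(1 / f 2) ^ 0 = 1` makes the estimate trivial. Each level of the
        -- tree gains a factor of at most `1 / f 2`, so a large `d` makes this slack small.
        | zero => exact triv hnorm (hbase0 n) (by rw [pow_zero]; linarith [hbase0 n])
        | succ d =>
          have hqd0 : 0 ≤ (1 / f 2) ^ d := pow_nonneg hq0 d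
          have hqd1 : (1 / f 2) ^ d ≤ 1 := pow_le_one₀ hq0
            (by rw [div_le_one (by linarith [one_lt_f le_rfl])]; exact (one_lt_f le_rfl).le)
          have hc0 : 0 ≤ χ (sel n) n := (hχ _).nonneg n
          have hc1 : χ (sel n) n ≤ 1 := (hχ _).le_one n
          have hstep : ∀ j, |pair (φ j) (avg (x n) (k n))| ≤
              (hits (x n) (k n) (G j) / k n) * (χ (sel n) n + (1 / f 2) ^ d) +
                (depthErr (M n) d / k n +
                  (∑ p ∈ G j, |avg (x n) (k n) p|) / f (M (n + 1))) := by
            intro j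
            rw [← add_assoc]
            refine (hbound j n d).trans ?_
            by_cases hj : hit n j
            · have := (hsel1 n ⟨j, hj⟩).2 j hj
              gcongr
            · rw [hits_eq_zero hj]
              simp
          have hsum := Finset.sum_le_sum fun j (_ : j ∈ Finset.univ) => hstep j
          rw [Finset.sum_add_distrib, Finset.sum_add_distrib, ← Finset.sum_mul,
            Finset.sum_const, Finset.card_univ, Fintype.card_fin, nsmul_eq_mul, ← Finset.sum_div,
            ← Finset.sum_div] at hsum
          have hhits : (∑ j, (hits (x n) (k n) (G j) : ℝ)) ≤ hits (x n) (k n) E + m := by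
            exact_mod_cast sum_hits_le (hin n) hG hGE
          have hη := div_le_div_of_nonneg_right (hl1 n) (hfM n).le
          have hβ := depthErr_nonneg (M n) d
          have hmM : (m : ℝ) ≤ M n := by exact_mod_cast hmn.le
          have hk0 : (0 : ℝ) ≤ k n := by positivity
          -- The recursion of `depthErr`: there are `m < M n` inherited errors, and at most `m`
          -- excess hits, each of weight at most `2 / k n`.
          have hβ' : m * (depthErr (M n) d / k n) + 2 * (m / k n) ≤
              depthErr (M n) (d + 1) / k n := by
            rw [depthErr, ← mul_div_assoc, ← mul_div_assoc, ← add_div]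
            refine div_le_div_of_nonneg_right ?_ hk0
            nlinarith
          have hmain : 1 / f m * ((∑ j, (hits (x n) (k n) (G j) : ℝ)) / k n *
              (χ (sel n) n + (1 / f 2) ^ d)) ≤
              (hits (x n) (k n) E / k n) * (base n + (1 / f 2) ^ (d + 1)) + 2 * (m / k n) := by
            by_cases hn : n ∈ A
            · have hb : base n = 1 / f m * χ (sel n) n := if_pos hn
              have e1 : (∑ j, (hits (x n) (k n) (G j) : ℝ)) / k n ≤
                  hits (x n) (k n) E / k n + m / k n := by
                rw [← add_div]; exact div_le_div_of_nonneg_right hhits hk0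
              have e2 : 0 ≤ χ (sel n) n + (1 / f 2) ^ d := by linarith
              have e3 := mul_le_mul_of_nonneg_left
                (mul_le_mul_of_nonneg_right e1 e2) (inv_f_nonneg hm)
              have e4 : 1 / f m * (m / k n * (χ (sel n) n + (1 / f 2) ^ d)) ≤ 2 * (m / k n) := by
                have : (0 : ℝ) ≤ m / k n := by positivity
                refine inv_f_mul_le hm (by positivity) ?_
                nlinarith
              have e5 : hits (x n) (k n) E / k n * (1 / f m * (1 / f 2) ^ d) ≤
                  hits (x n) (k n) E / k n * (1 / f 2) ^ (d + 1) := by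
                rw [pow_succ']
                exact mul_le_mul_of_nonneg_left (mul_le_mul_of_nonneg_right hfm2 hqd0) hθ0
              rw [hb]
              refine e3.trans ?_
              have e6 : 1 / f m * ((hits (x n) (k n) E / k n + m / k n) *
                  (χ (sel n) n + (1 / f 2) ^ d)) =
                  hits (x n) (k n) E / k n * (1 / f m * χ (sel n) n) +
                  hits (x n) (k n) E / k n * (1 / f m * (1 / f 2) ^ d) +
                  1 / f m * (m / k n * (χ (sel n) n + (1 / f 2) ^ d)) := by ring
              rw [e6, mul_add]
              linarith
            · have : ∀ j, (hits (x n) (k n) (G j) : ℝ) = 0 := fun j => by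
                rw [hits_eq_zero fun h' => hn ⟨j, h'⟩, Nat.cast_zero]
              simp only [this, Finset.sum_const_zero, zero_div, zero_mul, mul_zero]
              have := hbase0 n
              positivity
          refine (hpair n).trans ((mul_le_mul_of_nonneg_left hsum (inv_f_nonneg hm)).trans ?_)
          rw [mul_add]
          have hrest : 1 / f m * (m * (depthErr (M n) d / k n) +
              (∑ j, ∑ p ∈ G j, |avg (x n) (k n) p|) / f (M (n + 1))) ≤
              m * (depthErr (M n) d / k n) +
                (∑ p ∈ E, |avg (x n) (k n) p|) / f (M (n + 1)) := by
            refine inv_f_mul_le hm (add_nonneg (by positivity) (div_nonneg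
              (Finset.sum_nonneg fun j _ => Finset.sum_nonneg fun _ _ => abs_nonneg _)
              (hfM n).le)) ?_
            linarith
          linarith
      -- For `m ≥ M (n + 1)` the weight alone suffices against the `ℓ₁` mass of the average.
      · have h1 : |pair (fun n => 1 / f m * ∑ j, φ j n) (avg (x n) (k n))| ≤
            (∑ p ∈ E, |avg (x n) (k n) p|) / f (M (n + 1)) := by
          refine (hpair n).trans ?_
          have h2 : ∑ j, |pair (φ j) (avg (x n) (k n))| ≤ ∑ p ∈ E, |avg (x n) (k n) p| :=
            (Finset.sum_le_sum fun j _ => (h j).abs_pair_le_sum _).trans (hl1 n)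
          rw [one_div_mul_eq_div]
          exact div_le_div₀ (Finset.sum_nonneg fun _ _ => abs_nonneg _) h2 (hfM n) (f_mono hmn)
        have h3 : 0 ≤ depthErr (M n) d / k n := div_nonneg (depthErr_nonneg _ _) (by positivity)
        have h4 := mul_nonneg hθ0 (add_nonneg (hbase0 n) hqd)
        linarith
    -- The window containing `m` determines the attached coordinate. Below `M 0` there is none,
    -- which is why attachment occurs only at nodes with `F₀ ≤ f m`.
    by_cases hmid : ∃ n₀, M n₀ ≤ m ∧ m < M (n₀ + 1)
    · obtain ⟨n₀, hn₀, hn₁⟩ := hmid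
      refine ⟨fun n => if n = n₀ then 1 else base n,
        .attach m hm (hF.trans (f_mono ((hM.monotone (Nat.zero_le _)).trans hn₀))) n₀ A sel hmono χ
          hχ _ ?_ ?_ ?_ ?_, fun n d => ?_⟩
      · intro n
        split_ifs
        exacts [zero_le_one, hbase0 n]
      · simp
      · intro n hn hne
        simp [hne, hbase, hn]
      · intro n hn hne
        simp [hne, hbase, hn]
      · by_cases hnn : n = n₀
        · exact triv hnorm (ψ := fun n => if n = n₀ then 1 else base n) (by simp [hnn])
            (by simp only [hnn, if_true]; linarith [pow_nonneg hq0 d])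
        · simp only [hnn, if_false]
          refine generic n d ?_
          rcases lt_or_gt_of_ne hnn with hlt | hlt
          · exact Or.inr ((hM.monotone (Nat.succ_le_of_lt hlt)).trans hn₀)
          · exact Or.inl (hn₁.trans_le (hM.monotone (Nat.succ_le_of_lt hlt)))
    · have hm0 : m < M 0 := by
        by_contra! h0
        refine hmid ?_
        have hex : ∃ n, m < M n := ⟨m + 1, (Nat.lt_succ_self m).trans_le (hM.id_le _)⟩
        have hpos : Nat.find hex ≠ 0 := fun h' => by
          have := Nat.find_spec hex
          rw [h'] at this
          omega
        obtain ⟨n, hn⟩ := Nat.exists_eq_succ_of_ne_zero hpos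
        refine ⟨n, not_lt.1 (Nat.find_min hex (by omega)), ?_⟩
        have := Nat.find_spec hex
        rwa [hn] at this
      refine ⟨base, .node m hm A sel hmono χ hχ base hbase0 ?_ ?_, fun n d =>
        generic n d (Or.inl (hm0.trans_le (hM.monotone (Nat.zero_le n))))⟩
      · intro n hn
        simp [hbase, hn]
      · intro n hn
        simp [hbase, hn]

theorem sum_half_pow_le (s : Finset ℕ) : ∑ i ∈ s, (1 / 2 : ℝ) ^ i ≤ 2 :=
  (summable_geometric_two.sum_le_tsum _ fun _ _ => by positivity).trans tsum_geometric_two.le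

/-- Rapidly increasing averages of successive vectors are dominated by the unit vector basis. -/
theorem sNorm_sum_avg_le {x : ℕ → ℕ → ℕ →₀ ℝ} {k M d : ℕ → ℕ}
    (hM : StrictMono M) (hF : 57600 ≤ f (M 0)) (hx : ∀ n i, sNorm (x n i) ≤ 1)
    (hin : ∀ n i j, i < j → j < k n → Before (x n i).support (x n j).support)
    (hout : ∀ n n' i i', n < n' → i < k n → i' < k n' →
      Before (x n i).support (x n' i').support)
    (hd : ∀ n, (1 / f 2) ^ d n ≤ (1 / 2) ^ n)
    (hk : ∀ n, depthErr (M n) (d n) / k n ≤ (1 / 2) ^ n)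
    (hl : ∀ n, ell1 (avg (x n) (k n)) / f (M (n + 1)) ≤ (1 / 2) ^ n) (a : ℕ →₀ ℝ) :
    sNorm (∑ n ∈ a.support, a n • avg (x n) (k n)) ≤ 12 * sNorm a := by
  refine sNorm_le_of_pair_le fun φ hφ => ?_
  obtain ⟨ψ, hψ, hb⟩ := hφ.exists_adm hM hF hx hin hout
  -- The depth slack, the splitting error and the `ℓ₁` error contribute `(1 / 2) ^ n` each. Summed
  -- against the coefficients they cost `6 * sNorm a`, so the final constant is `6 + 6`.
  have hb' : ∀ n, |pair φ (avg (x n) (k n))| ≤ ψ n + 3 * (1 / 2) ^ n := by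
    intro n
    refine (hb n (d n)).trans ?_
    have hθ : (hits (x n) (k n) (∑ n ∈ a.support, a n • avg (x n) (k n)).support : ℝ) / k n ≤ 1 :=
      div_le_one_of_le₀ (by exact_mod_cast hits_le _ _ _) (by positivity)
    have h1 : 0 ≤ ψ n + (1 / f 2) ^ d n :=
      add_nonneg (hψ.nonneg n) (pow_nonneg (inv_f_nonneg le_rfl) _)
    have h2 : ∑ p ∈ (∑ n ∈ a.support, a n • avg (x n) (k n)).support, |avg (x n) (k n) p| ≤
        ell1 (avg (x n) (k n)) := by
      classical
      unfold ell1
      refine (Finset.sum_le_sum_of_subset_of_nonneg Finset.subset_union_left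
        fun _ _ _ => abs_nonneg _).trans (le_of_eq (Finset.sum_subset
          Finset.subset_union_right fun p _ hp => ?_).symm)
      rw [Finsupp.notMem_support_iff.1 hp, abs_zero]
    have hfM : 0 ≤ f (M (n + 1)) := by
      have : 1 ≤ M (n + 1) := (Nat.zero_le _).trans_lt (hM (Nat.lt_succ_self n))
      linarith [one_le_f this]
    have h3 := (div_le_div_of_nonneg_right h2 hfM).trans (hl n)
    have h4 := mul_le_mul_of_nonneg_right hθ h1
    linarith [hd n, hk n]
  rw [map_sum]
  calc ∑ n ∈ a.support, pair φ (a n • avg (x n) (k n))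
      ≤ ∑ n ∈ a.support, (ψ n * |a n| + 3 * sNorm a * (1 / 2) ^ n) := by
        refine Finset.sum_le_sum fun n _ => ?_
        rw [map_smul, smul_eq_mul]
        refine (le_abs_self _).trans ?_
        rw [abs_mul]
        have h1 := mul_le_mul_of_nonneg_left (hb' n) (abs_nonneg (a n))
        have h2 : (0 : ℝ) ≤ 3 * (1 / 2) ^ n := by positivity
        have h3 := mul_le_mul_of_nonneg_right (abs_le_sNorm a n) h2
        linarith
    _ = absPair ψ a + 3 * sNorm a * ∑ n ∈ a.support, (1 / 2 : ℝ) ^ n := by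
        rw [Finset.sum_add_distrib, ← Finset.mul_sum]; rfl
    _ ≤ 6 * sNorm a + 3 * sNorm a * 2 := by
        exact add_le_add (hψ.bound_and_hasNode.1 a)
          (mul_le_mul_of_nonneg_left (sum_half_pow_le _) (by linarith [sNorm_nonneg a]))
    _ = 12 * sNorm a := by ring

/-! ### Constructing averages in block subspaces. -/

/-- Supports of a sequence in `c₀₀` are successive. -/
def IsBlock (z : ℕ → ℕ →₀ ℝ) : Prop := ∀ m n, m < n → Before (z m).support (z n).support

theorem exists_of_mem_support_linearCombination {z : ℕ → ℕ →₀ ℝ} {b : ℕ →₀ ℝ} {p : ℕ}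
    (hp : p ∈ (Finsupp.linearCombination ℝ z b).support) :
    ∃ i ∈ b.support, p ∈ (z i).support := by
  by_contra! h
  refine Finsupp.mem_support_iff.1 hp ?_
  rw [Finsupp.linearCombination_apply, Finsupp.sum, Finsupp.finsetSum_apply]
  refine Finset.sum_eq_zero fun i hi => ?_
  rw [Finsupp.smul_apply, Finsupp.notMem_support_iff.1 (h i hi), smul_zero]

theorem IsBlock.before_linearCombination {z : ℕ → ℕ →₀ ℝ} (hz : IsBlock z) {b c : ℕ →₀ ℝ}
    (h : Before b.support c.support) :
    Before (Finsupp.linearCombination ℝ z b).support (Finsupp.linearCombination ℝ z c).support := by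
  intro p hp q hq
  obtain ⟨i, hi, hp⟩ := exists_of_mem_support_linearCombination hp
  obtain ⟨j, hj, hq⟩ := exists_of_mem_support_linearCombination hq
  exact hz i j (h i hi j hj) p hp q hq

theorem IsBlock.proj_linearCombination {z : ℕ → ℕ →₀ ℝ} (hz : IsBlock z) (b : ℕ →₀ ℝ) (n : ℕ) :
    proj (z n).support (Finsupp.linearCombination ℝ z b) = b n • z n := by
  have h1 : ∀ m, m ≠ n → proj (z n).support (z m) = 0 := by
    intro m hm
    ext p
    rw [proj_apply]
    split_ifs with hp
    · by_contra h'
      have h' := Finsupp.mem_support_iff.2 h'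
      rcases lt_or_gt_of_ne hm with h | h
      · exact lt_irrefl _ (hz m n h p h' p hp)
      · exact lt_irrefl _ (hz n m h p hp p h')
    · rfl
  have h2 : ∀ s : Finset ℕ, proj (z n).support (∑ i ∈ s, b i • z i) =
      ∑ i ∈ s, b i • proj (z n).support (z i) := by
    classical
    intro s
    induction s using Finset.induction_on with
    | empty => ext p; rw [proj_apply]; simp
    | insert i s hi ih => rw [Finset.sum_insert hi, Finset.sum_insert hi, proj_add, ih, proj_smul]
  rw [Finsupp.linearCombination_apply, Finsupp.sum, h2]
  by_cases hn : n ∈ b.support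
  · rw [Finset.sum_eq_single_of_mem n hn, proj_eq_self (Finset.Subset.refl _)]
    intro m _ hm
    rw [h1 m hm, smul_zero]
  · rw [Finset.sum_eq_zero, Finsupp.notMem_support_iff.1 hn, zero_smul]
    intro m hm
    rw [h1 m (ne_of_mem_of_not_mem hm hn), smul_zero]

theorem f_pow_le (k r : ℕ) : f (k ^ r) ≤ k * r + 1 := by
  refine f_le_of_le ?_
  have h1 : k ^ r + 1 ≤ 2 ^ (k * r + 1) := by
    have h2 : k ^ r ≤ 2 ^ (k * r) := by
      rw [pow_mul]
      exact Nat.pow_le_pow_left Nat.lt_two_pow_self.le r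
    have h3 : 1 ≤ 2 ^ (k * r) := Nat.one_le_two_pow
    rw [pow_succ]
    omega
  have h4 : (((k ^ r : ℕ) : ℝ)) + 1 ≤ 2 ^ (k * r + 1) := by exact_mod_cast h1
  refine h4.trans (le_of_eq ?_)
  rw [← Real.rpow_natCast]
  push_cast
  rfl

theorem mul_add_one_lt_two_pow (k : ℕ) : k * (k + 5) + 1 < 2 ^ (k + 5) := by
  induction k with
  | zero => norm_num
  | succ k ih =>
    rw [show k + 1 + 5 = (k + 5) + 1 by ring, pow_succ]
    nlinarith [Nat.lt_two_pow_self (n := k + 5)]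

/-- Every block subspace contains `ℓ₁`-like blocks of every length. -/
theorem IsBlock.exists_ell1 {z : ℕ → ℕ →₀ ℝ} (hz : IsBlock z) (hz0 : ∀ n, z n ≠ 0)
    {k : ℕ} (hk : 2 ≤ k) (N : ℕ) :
    ∃ b : ℕ → ℕ →₀ ℝ, (∀ i, ∀ p ∈ (b i).support, N ≤ p) ∧
      (∀ i j, i < j → Before (b i).support (b j).support) ∧
      (∀ i, sNorm (Finsupp.linearCombination ℝ z (b i)) ≤ 1) ∧
      (k : ℝ) / 2 ≤ sNorm (∑ i ∈ Finset.range k, Finsupp.linearCombination ℝ z (b i)) := by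
  -- James' iteration: if sums of `k` blocks always fell below `k / 2`, sums of `k ^ r` normalized
  -- blocks would be at most `(k / 2) ^ r`, whereas the implicit equation forces at least `k ^ r / f
  -- (k ^ r)`.
  by_contra! H
  set w : ℕ → ℕ → ℕ →₀ ℝ := fun r s =>
    ∑ i ∈ Finset.Ico s (s + k ^ r), Finsupp.single i (1 / sNorm (z i)) with hw
  have hsupp : ∀ r s p, p ∈ (w r s).support → s ≤ p ∧ p < s + k ^ r := by
    intro r s p hp
    by_contra h'
    refine Finsupp.mem_support_iff.1 hp ?_
    rw [hw, Finsupp.finsetSum_apply]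
    refine Finset.sum_eq_zero fun i hi => Finsupp.single_eq_of_ne fun h'' => h' ?_
    rw [h'']
    exact Finset.mem_Ico.1 hi
  have hstep : ∀ r s, w (r + 1) s = ∑ j ∈ Finset.range k, w r (s + j * k ^ r) := by
    intro r s
    have : ∀ K, ∑ i ∈ Finset.Ico s (s + K * k ^ r), Finsupp.single i (1 / sNorm (z i)) =
        ∑ j ∈ Finset.range K, w r (s + j * k ^ r) := by
      intro K
      induction K with
      | zero => simp
      | succ K ih =>
        rw [Finset.sum_range_succ, ← ih, hw]
        simp only
        rw [Finset.sum_Ico_consecutive _ (by omega) (by omega), add_assoc, ← Nat.succ_mul]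
    rw [← this k, ← pow_succ']
  have hupper : ∀ r s, N ≤ s →
      sNorm (Finsupp.linearCombination ℝ z (w r s)) ≤ ((k : ℝ) / 2) ^ r := by
    have hk0 : (0 : ℝ) < (k : ℝ) / 2 := by positivity
    intro r
    induction r with
    | zero =>
      intro s _
      have h0 := sNorm_pos (hz0 s)
      rw [pow_zero, hw]
      simp only [pow_zero, Nat.Ico_succ_singleton, Finset.sum_singleton,
        Finsupp.linearCombination_single]
      rw [sNorm_smul, abs_of_pos (by positivity), one_div, inv_mul_cancel₀ h0.ne']
    | succ r ih =>
      intro s hs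
      have hc : 0 < (((k : ℝ) / 2) ^ r)⁻¹ := by positivity
      have h1 := H (fun j => (((k : ℝ) / 2) ^ r)⁻¹ • w r (s + j * k ^ r)) ?_ ?_ ?_
      · simp only [map_smul] at h1
        rw [← Finset.smul_sum, sNorm_smul, abs_of_pos hc, ← map_sum, ← hstep,
          inv_mul_lt_iff₀ (by positivity)] at h1
        rw [pow_succ]
        exact h1.le
      · intro i p hp
        have := (hsupp _ _ p (Finsupp.support_smul hp)).1
        exact hs.trans (le_trans (Nat.le_add_right _ _) this)
      · intro i j hij p hp q hq
        have h1 := (hsupp _ _ p (Finsupp.support_smul hp)).2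
        have h2 := (hsupp _ _ q (Finsupp.support_smul hq)).1
        have h3 : (i + 1) * k ^ r ≤ j * k ^ r := Nat.mul_le_mul_right _ hij
        rw [add_mul, one_mul] at h3
        omega
      · intro i
        rw [map_smul, sNorm_smul, abs_of_pos hc, inv_mul_le_iff₀ (by positivity), mul_one]
        exact ih _ (hs.trans (Nat.le_add_right _ _))
  have hlower : ∀ r s, (k : ℝ) ^ r ≤
      f (k ^ r) * sNorm (Finsupp.linearCombination ℝ z (w r s)) := by
    intro r s
    have hpos : 1 ≤ k ^ r := Nat.one_le_pow _ _ (by omega)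
    have hE : Successive fun i : Fin (k ^ r) => (z (s + i)).support :=
      fun i j hij => hz _ _ (by simpa using hij)
    refine le_trans (le_of_eq ?_) (sum_sNorm_proj_le hpos hE _)
    have : ∀ i : Fin (k ^ r), sNorm (proj (z (s + i)).support
        (Finsupp.linearCombination ℝ z (w r s))) = 1 := by
      intro i
      rw [hz.proj_linearCombination]
      have h1 : w r s (s + i) = 1 / sNorm (z (s + i)) := by
        rw [hw, Finsupp.finsetSum_apply, Finset.sum_eq_single_of_mem (s + (i : ℕ)),
          Finsupp.single_eq_same]
        · rw [Finset.mem_Ico]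
          exact ⟨Nat.le_add_right _ _, by omega⟩
        · intro j _ hj
          exact Finsupp.single_eq_of_ne hj.symm
      have h0 := sNorm_pos (hz0 (s + i))
      rw [h1, sNorm_smul, abs_of_pos (by positivity), one_div, inv_mul_cancel₀ h0.ne']
    simp [this]
  -- The depth `r = k + 5` is enough: the two bounds would give `2 ^ r ≤ f (k ^ r) ≤ k * r + 1`.
  have h1 := (hlower (k + 5) N).trans (mul_le_mul_of_nonneg_left (hupper (k + 5) N le_rfl)
    (zero_le_one.trans (one_le_f (Nat.one_le_pow _ _ (by omega)))))
  have hkpos : (0 : ℝ) < (k : ℝ) ^ (k + 5) := by positivity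
  rw [div_pow, mul_div_assoc', le_div_iff₀ (by positivity), mul_comm (f _)] at h1
  have h2 := (le_of_mul_le_mul_left h1 hkpos).trans (f_pow_le k (k + 5))
  have h3 : (k : ℝ) * ((k + 5 : ℕ) : ℝ) + 1 < 2 ^ (k + 5) := by
    exact_mod_cast mul_add_one_lt_two_pow k
  linarith

theorem exists_le_f (b : ℝ) : ∃ M₀ : ℕ, ∀ M, M₀ ≤ M → b ≤ f M := by
  obtain ⟨M₀, hM₀⟩ := exists_nat_ge ((2 : ℝ) ^ b)
  refine ⟨M₀, fun M hM => ?_⟩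
  unfold f
  rw [Real.le_logb_iff_rpow_le (by norm_num) (by positivity)]
  have : (M₀ : ℝ) ≤ M := by exact_mod_cast hM
  linarith

/-- One step of the construction of a rapidly increasing sequence of `ℓ₁`-averages. -/
theorem IsBlock.exists_average {z : ℕ → ℕ →₀ ℝ} (hz : IsBlock z) (hz0 : ∀ n, z n ≠ 0)
    {δ : ℝ} (hδ : 0 < δ) (M N : ℕ) :
    ∃ (k d : ℕ) (b : ℕ → ℕ →₀ ℝ) (M' N' : ℕ), (1 / f 2) ^ d ≤ δ ∧ depthErr M d / k ≤ δ ∧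
      (∀ i < k, ∀ p ∈ (b i).support, N ≤ p ∧ p < N') ∧
      (∀ i j, i < j → Before (b i).support (b j).support) ∧
      (∀ i, sNorm (Finsupp.linearCombination ℝ z (b i)) ≤ 1) ∧
      1 / 2 ≤ sNorm (avg (fun i => Finsupp.linearCombination ℝ z (b i)) k) ∧ M < M' ∧
      ell1 (avg (fun i => Finsupp.linearCombination ℝ z (b i)) k) / f M' ≤ δ := by
  classical
  have hf2 := one_lt_f le_rfl
  -- The order of choice is forced: `d` depends on `δ`, `k` on `M` and `d`, the average on `k`, and
  -- the next threshold on the `ℓ₁` norm of the average.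
  obtain ⟨d, hd⟩ := exists_pow_lt_of_lt_one hδ
    (show 1 / f 2 < 1 by rw [div_lt_one (by linarith)]; exact hf2)
  obtain ⟨k₀, hk₀⟩ := exists_nat_ge (depthErr M d / δ)
  set k := k₀ + 2 with hk
  obtain ⟨b, hb1, hb2, hb3, hb4⟩ := hz.exists_ell1 hz0 (show 2 ≤ k by omega) N
  set y := avg (fun i => Finsupp.linearCombination ℝ z (b i)) k with hy
  obtain ⟨M₀, hM₀⟩ := exists_le_f (max 1 (ell1 y / δ))
  have hk0 : (0 : ℝ) < k := by positivity
  refine ⟨k, d, b, max M₀ (M + 1), ((Finset.range k).biUnion fun i => (b i).support).sup id + 1,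
    hd.le, ?_, fun i hi p hp => ⟨hb1 i p hp, ?_⟩, hb2, hb3, ?_, by omega, ?_⟩
  · rw [div_le_iff₀ hδ] at hk₀
    rw [div_le_iff₀ hk0, hk]
    push_cast
    nlinarith
  · exact Nat.lt_succ_of_le (Finset.le_sup (f := id)
      (Finset.mem_biUnion.2 ⟨i, Finset.mem_range.2 hi, hp⟩))
  · rw [avg, sNorm_smul, abs_of_pos (by positivity), one_div_mul_eq_div, le_div_iff₀ hk0]
    linarith
  · have h1 := hM₀ _ (le_max_left M₀ (M + 1))
    have h2 := (le_max_left _ _).trans h1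
    have h3 := (le_max_right _ _).trans h1
    rw [div_le_iff₀ (by linarith)]
    rw [div_le_iff₀ hδ] at h3
    linarith

/-- Every block sequence has a normalized further block sequence dominated by the basis. -/
theorem IsBlock.exists_block {z : ℕ → ℕ →₀ ℝ} (hz : IsBlock z) (hz0 : ∀ n, z n ≠ 0) :
    ∃ c : ℕ → ℕ →₀ ℝ, IsBlock c ∧ (∀ n, sNorm (Finsupp.linearCombination ℝ z (c n)) = 1) ∧
      ∀ a, sNorm (Finsupp.linearCombination ℝ (fun n => Finsupp.linearCombination ℝ z (c n)) a) ≤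
        24 * sNorm a := by
  have hδ : ∀ n : ℕ, (0 : ℝ) < (1 / 2) ^ n := fun n => by positivity
  choose k d b M' N' h1 h2 h3 h4 h5 h6 h7 h8 using
    fun n M N => hz.exists_average hz0 (hδ n) M N
  obtain ⟨M₀, hM₀⟩ := exists_le_f 57600
  -- The state carries the current size threshold and the first index still free.
  set st : ℕ → ℕ × ℕ := fun n => Nat.rec (M₀, 0) (fun n s => (M' n s.1 s.2, N' n s.1 s.2)) n
    with hst
  have hst1 : ∀ n, st (n + 1) = (M' n (st n).1 (st n).2, N' n (st n).1 (st n).2) := fun n => rfl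
  set K : ℕ → ℕ := fun n => k n (st n).1 (st n).2 with hK
  set B : ℕ → ℕ → ℕ →₀ ℝ := fun n => b n (st n).1 (st n).2 with hB
  have hM : StrictMono fun n => (st n).1 := strictMono_nat_of_lt_succ fun n => h7 n _ _
  have hlt : ∀ n i, i < K n → ∀ p ∈ (B n i).support, (st n).2 ≤ p ∧ p < (st (n + 1)).2 :=
    fun n i hi => h3 n _ _ i hi
  have hN : Monotone fun n => (st n).2 := by
    refine monotone_nat_of_le_succ fun n => ?_
    -- The free index advances only past nonempty supports; some support is nonempty because the
    -- average has norm at least `1 / 2`.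
    by_cases hne : ∃ i < K n, (B n i).support.Nonempty
    · obtain ⟨i, hi, p, hp⟩ := hne
      have := hlt n i hi p hp
      exact (this.1.trans this.2.le)
    · exfalso
      push Not at hne
      have h := h6 n (st n).1 (st n).2
      change 1 / 2 ≤ sNorm (avg (fun i => Finsupp.linearCombination ℝ z (B n i)) (K n)) at h
      rw [avg, Finset.sum_eq_zero, smul_zero, sNorm_zero] at h
      · norm_num at h
      · intro i hi
        have := hne i (Finset.mem_range.1 hi)
        rw [Finsupp.support_eq_empty.1 this, map_zero]
  have hBout : ∀ n n' i i', n < n' → i < K n → i' < K n' →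
      Before (B n i).support (B n' i').support := by
    intro n n' i i' hn hi hi' p hp q hq
    have e1 := (hlt n i hi p hp).2
    have e2 := (hlt n' i' hi' q hq).1
    exact e1.trans_le ((hN (Nat.succ_le_of_lt hn)).trans e2)
  set X : ℕ → ℕ → ℕ →₀ ℝ := fun n i => Finsupp.linearCombination ℝ z (B n i) with hX
  set y : ℕ → ℕ →₀ ℝ := fun n => avg (X n) (K n) with hy
  have hy2 : ∀ n, 1 / 2 ≤ sNorm (y n) := fun n => h6 n _ _
  have hmain : ∀ a : ℕ →₀ ℝ, sNorm (∑ n ∈ a.support, a n • y n) ≤ 12 * sNorm a :=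
    sNorm_sum_avg_le hM (hM₀ M₀ le_rfl) (fun n i => h5 n _ _ i)
      (fun n i j hij _ => hz.before_linearCombination (h4 n _ _ i j hij))
      (fun n n' i i' hn hi hi' => hz.before_linearCombination (hBout n n' i i' hn hi hi'))
      (fun n => h1 n _ _) (fun n => h2 n _ _) (fun n => h8 n _ _)
  set c : ℕ → ℕ →₀ ℝ := fun n =>
    (1 / sNorm (y n)) • (1 / (K n : ℝ)) • ∑ i ∈ Finset.range (K n), B n i with hc
  have hyc : ∀ n, Finsupp.linearCombination ℝ z (c n) = (1 / sNorm (y n)) • y n := by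
    intro n
    rw [hc, map_smul, map_smul, map_sum]
    rfl
  have hcsupp : ∀ n, ∀ p ∈ (c n).support, ∃ i < K n, p ∈ (B n i).support := by
    intro n p hp
    by_contra! h
    have h1 := Finsupp.support_smul (Finsupp.support_smul hp)
    refine Finsupp.mem_support_iff.1 h1 ?_
    rw [Finsupp.finsetSum_apply]
    exact Finset.sum_eq_zero fun i hi =>
      Finsupp.notMem_support_iff.1 (h i (Finset.mem_range.1 hi))
  refine ⟨c, ?_, ?_, ?_⟩
  · intro m n hmn p hp q hq
    obtain ⟨i, hi, hp⟩ := hcsupp m p hp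
    obtain ⟨j, hj, hq⟩ := hcsupp n q hq
    exact hBout m n i j hmn hi hj p hp q hq
  · intro n
    have := hy2 n
    rw [hyc, sNorm_smul, abs_of_pos (by positivity), one_div, inv_mul_cancel₀ (by linarith)]
  · intro a
    have hpos : ∀ n, 0 < sNorm (y n) := fun n => by linarith [hy2 n]
    -- The normalization is moved into the coefficients. The averages have norm at least `1 / 2`, so
    -- this at most doubles the constant, from `12` to `24`.
    set a' : ℕ →₀ ℝ := Finsupp.onFinset a.support (fun n => a n * (1 / sNorm (y n)))
      fun n hn => Finsupp.mem_support_iff.2 (left_ne_zero_of_mul hn) with ha'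
    have e1 : Finsupp.linearCombination ℝ (fun n => Finsupp.linearCombination ℝ z (c n)) a =
        ∑ n ∈ a'.support, a' n • y n := by
      rw [Finsupp.linearCombination_apply, Finsupp.sum]
      have hsub : a'.support ⊆ a.support := Finsupp.support_onFinset_subset
      rw [Finset.sum_subset hsub fun n _ hn => by
        rw [Finsupp.notMem_support_iff.1 hn, zero_smul]]
      refine Finset.sum_congr rfl fun n _ => ?_
      rw [hyc, smul_smul]
      rfl
    have e2 : sNorm a' ≤ 2 * sNorm a := by
      have e3 : sNorm ((2 : ℝ) • a) = 2 * sNorm a := by rw [sNorm_smul]; norm_num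
      rw [← e3]
      refine sNorm_mono_abs fun n => ?_
      have e4 : 1 / sNorm (y n) ≤ 2 := by
        rw [div_le_iff₀ (hpos n)]
        linarith [hy2 n]
      rw [ha', Finsupp.onFinset_apply, Finsupp.smul_apply, smul_eq_mul, abs_mul, abs_mul,
        abs_of_pos (one_div_pos.2 (hpos n)), abs_of_pos (zero_lt_two (α := ℝ)), mul_comm]
      exact mul_le_mul_of_nonneg_right e4 (abs_nonneg _)
    rw [e1]
    linarith [hmain a']

/-! ### Operators on `S` and the block basis statement. -/

/-- The inclusion of `c₀₀` into `S`. -/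
noncomputable def incl : (ℕ →₀ ℝ) →ₗ[ℝ] S :=
  (UniformSpace.Completion.toComplL (𝕜 := ℝ) (E := C00) : C00 →ₗ[ℝ] S)

theorem norm_incl (x : ℕ →₀ ℝ) : ‖incl x‖ = sNorm x :=
  (UniformSpace.Completion.norm_coe (show C00 from x)).trans (norm_C00 x)

theorem denseRange_incl : DenseRange incl := UniformSpace.Completion.denseRange_coe (α := C00)

theorem incl_single (n : ℕ) : incl (Finsupp.single n 1) = e n := rfl

theorem incl_eq (x : ℕ →₀ ℝ) : Finsupp.linearCombination ℝ e x = incl x := by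
  have : Finsupp.linearCombination ℝ e = incl := by
    ext n
    simp [incl_single]
  rw [this]

theorem incl_linearCombination (z : ℕ → ℕ →₀ ℝ) (b : ℕ →₀ ℝ) :
    Finsupp.linearCombination ℝ (fun n => incl (z n)) b =
      incl (Finsupp.linearCombination ℝ z b) :=
  (Finsupp.apply_linearCombination ℝ incl z b).symm

/-- Bounded linear maps on `c₀₀` extend to `S`. -/
theorem exists_extension {F : Type*} [NormedAddCommGroup F] [NormedSpace ℝ F] [CompleteSpace F]
    (T : (ℕ →₀ ℝ) →ₗ[ℝ] F) {C : ℝ} (h : ∀ x, ‖T x‖ ≤ C * sNorm x) :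
    ∃ T' : S →L[ℝ] F, (∀ x, T' (incl x) = T x) ∧ ∀ s, ‖T' s‖ ≤ C * ‖s‖ := by
  let T₀ : C00 →L[ℝ] F := LinearMap.mkContinuous (show C00 →ₗ[ℝ] F from T) C h
  have h1 : ∀ x, T₀.fromCompletion (incl x) = T x := fun x =>
    ContinuousLinearMap.fromCompletion_apply_coe T₀ x
  refine ⟨T₀.fromCompletion, h1, fun s => ?_⟩
  refine denseRange_incl.induction_on s ?_ fun x => ?_
  · exact isClosed_le (by fun_prop) (by fun_prop)
  · rw [h1, norm_incl]
    exact h x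

theorem IsBlock.le_of_mem_support {z : ℕ → ℕ →₀ ℝ} (hz : IsBlock z) (hz0 : ∀ n, z n ≠ 0) {n p : ℕ}
    (hp : p ∈ (z n).support) : n ≤ p := by
  induction n generalizing p with
  | zero => exact Nat.zero_le p
  | succ n ih =>
    obtain ⟨q, hq⟩ := Finsupp.support_nonempty_iff.2 (hz0 n)
    exact (ih hq).trans_lt (hz n (n + 1) (Nat.lt_succ_self n) q hq p hp)

/-- A contraction of `S` which sends a given normalized block sequence to the unit vector basis. -/
theorem IsBlock.exists_coordinates {y : ℕ → ℕ →₀ ℝ} (hy : IsBlock y) (hy1 : ∀ n, sNorm (y n) = 1) :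
    ∃ U : S →L[ℝ] S, (∀ s, ‖U s‖ ≤ ‖s‖) ∧ ∀ n, U (incl (y n)) = e n := by
  have hy0 : ∀ n, y n ≠ 0 := fun n h => by
    have := hy1 n
    rw [h, sNorm_zero] at this
    exact zero_ne_one this
  choose g hg hgy using fun n => exists_dual_vector'' ℝ (show C00 from y n)
  have hgx : ∀ n (x : ℕ →₀ ℝ), |g n (show C00 from x)| ≤ sNorm x := by
    intro n x
    have := (g n).le_opNorm (show C00 from x)
    rw [Real.norm_eq_abs, norm_C00] at this
    exact this.trans ((mul_le_mul_of_nonneg_right (hg n) (sNorm_nonneg x)).trans (one_mul _).le)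
  let T : (ℕ →₀ ℝ) →ₗ[ℝ] (ℕ →₀ ℝ) :=
    -- The support of the `n`-th block lies in `[n, ∞)`, so only finitely many coordinates of the
    -- image are nonzero.
    { toFun := fun x => Finsupp.onFinset (Finset.range (x.support.sup id + 1))
        (fun n => g n (show C00 from proj (y n).support x)) (by
          intro n hn
          have hne : proj (y n).support x ≠ 0 := fun h => hn (by rw [h]; exact map_zero (g n))
          obtain ⟨p, hp⟩ := Finsupp.support_nonempty_iff.2 hne
          have hp := Finset.mem_inter.1 (support_proj_subset _ _ hp)
          exact Finset.mem_range.2 (Nat.lt_succ_of_le ((hy.le_of_mem_support hy0 hp.1).trans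
            (Finset.le_sup (f := id) hp.2))))
      map_add' := fun x x' => by
        ext n
        simp only [Finsupp.onFinset_apply, Finsupp.add_apply, proj_add]
        exact map_add (g n) _ _
      map_smul' := fun c x => by
        ext n
        simp only [Finsupp.onFinset_apply, Finsupp.smul_apply, proj_smul, RingHom.id_apply]
        exact map_smul (g n) _ _ }
  have hT : ∀ x n, T x n = g n (show C00 from proj (y n).support x) := fun x n => rfl
  have hTx : ∀ x, sNorm (T x) ≤ sNorm x := fun x =>
    sNorm_le_of_blocks hy _ _ fun n => hgx n _
  obtain ⟨U, hU1, hU2⟩ := exists_extension (incl ∘ₗ T) (C := 1) fun x => by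
    rw [LinearMap.comp_apply, norm_incl, one_mul]
    exact hTx x
  refine ⟨U, fun s => (hU2 s).trans (one_mul _).le, fun n => ?_⟩
  rw [hU1, LinearMap.comp_apply, ← incl_single]
  congr 1
  ext m
  have hlc : Finsupp.linearCombination ℝ y (Finsupp.single n 1) = y n := by simp
  rw [hT, ← hlc, hy.proj_linearCombination]
  by_cases hmn : m = n
  · subst hmn
    rw [Finsupp.single_eq_same, one_smul, hgy]
    exact hy1 m
  · rw [Finsupp.single_eq_of_ne hmn, zero_smul]
    exact map_zero (g m)

theorem range_le_of_forall_mem {P : Submodule ℝ S} (hP : IsClosed (P : Set S)) {V : S →L[ℝ] S}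
    (h : ∀ n, V (e n) ∈ P) (s : S) : V s ∈ P := by
  refine denseRange_incl.induction_on (p := fun s => V s ∈ P) s ?_ fun x => ?_
  · exact hP.preimage V.continuous
  · rw [← incl_eq, Finsupp.linearCombination_apply, Finsupp.sum, map_sum]
    exact P.sum_mem fun i _ => by
      rw [map_smul]
      exact P.smul_mem _ (h i)

/-- `V` is an isomorphism onto its range with projection `V U`; closedness of `P` lets membership be
checked on the basis only. -/
theorem exists_complemented_of_leftInverse {U V : S →L[ℝ] S} (h : ∀ s, U (V s) = s)
    {P : Submodule ℝ S} (hP : IsClosed (P : Set S)) (hV : ∀ n, V (e n) ∈ P) :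
    ∃ Z : Submodule ℝ S, Z ≤ P ∧ IsClosed (Z : Set S) ∧ Nonempty (Z ≃L[ℝ] S) ∧
      Z.ClosedComplemented := by
  have hc := V.closedComplemented_range_of_leftInverse U h
  refine ⟨V.range, ?_, hc.isClosed, ⟨(V.equivRange
    (Function.LeftInverse.injective h) hc.isClosed).symm⟩, hc⟩
  rintro _ ⟨s, rfl⟩
  exact range_le_of_forall_mem hP hV s

theorem topologicalClosure_span_eq_range {U V : S →L[ℝ] S} (h : ∀ s, U (V s) = s) :
    (Submodule.span ℝ (Set.range fun n => V (e n))).topologicalClosure = V.range := by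
  apply le_antisymm
  · refine Submodule.topologicalClosure_minimal _ (Submodule.span_le.2 ?_)
      (V.closedComplemented_range_of_leftInverse U h).isClosed
    rintro _ ⟨n, rfl⟩
    exact ⟨e n, rfl⟩
  · rintro _ ⟨s, rfl⟩
    exact range_le_of_forall_mem (Submodule.isClosed_topologicalClosure _)
      (fun n => Submodule.le_topologicalClosure _ (Submodule.subset_span (Set.mem_range_self n))) s

theorem leftInverse_of_basis {U V : S →L[ℝ] S} (h : ∀ n, U (V (e n)) = e n) (s : S) :
    U (V s) = s := by
  refine denseRange_incl.induction_on (p := fun s => U (V s) = s) s ?_ fun x => ?_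
  · exact isClosed_eq (by fun_prop) continuous_id
  · rw [← incl_eq, Finsupp.linearCombination_apply, Finsupp.sum, map_sum, map_sum]
    exact Finset.sum_congr rfl fun i _ => by rw [map_smul, map_smul, h]

/-- A bounded operator sending the unit vector basis to a dominated sequence. -/
theorem exists_operator (y : ℕ → S) {C : ℝ}
    (h : ∀ a, ‖Finsupp.linearCombination ℝ y a‖ ≤ C * sNorm a) :
    ∃ V : S →L[ℝ] S, (∀ n, V (e n) = y n) ∧ ∀ s, ‖V s‖ ≤ C * ‖s‖ := by
  obtain ⟨V, h1, h2⟩ := exists_extension (Finsupp.linearCombination ℝ y) h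
  refine ⟨V, fun n => ?_, h2⟩
  rw [← incl_single, h1, Finsupp.linearCombination_single, one_smul]

theorem exists_subsequence_equivalent (z : ℕ → S) (hz : IsBlockBasisOf z e) :
    ∃ y : ℕ → S, IsBlockBasisOf y z ∧ (∀ n, ‖y n‖ = 1) ∧ EquivalentSeq y e ∧
      (Submodule.span ℝ (Set.range y)).topologicalClosure.ClosedComplemented := by
  obtain ⟨x, hx0, hx, hzx⟩ := hz
  have hx : IsBlock x := hx
  have hzx : z = fun n => incl (x n) := by
    funext n
    rw [hzx, ← incl_eq, Finsupp.linearCombination_apply]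
  obtain ⟨c, hc, hc1, hc24⟩ := hx.exists_block hx0
  set y : ℕ → ℕ →₀ ℝ := fun n => Finsupp.linearCombination ℝ x (c n) with hy
  have hyb : IsBlock y := fun m n hmn => hx.before_linearCombination (hc m n hmn)
  have hup : ∀ a, ‖Finsupp.linearCombination ℝ (fun n => incl (y n)) a‖ ≤ 24 * sNorm a := by
    intro a
    rw [incl_linearCombination, norm_incl]
    exact hc24 a
  obtain ⟨V, hV, -⟩ := exists_operator _ hup
  obtain ⟨U, -, hU⟩ := hyb.exists_coordinates hc1
  have hUV := leftInverse_of_basis (U := U) (V := V) fun n => by rw [hV, hU]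
  refine ⟨fun n => incl (y n), ⟨c, fun n h => ?_, hc, fun n => ?_⟩, fun n => ?_, ⟨24, by norm_num,
    fun a => ?_⟩, ?_⟩
  · have := hc1 n
    rw [h, map_zero, sNorm_zero] at this
    exact zero_ne_one this
  · rw [hzx, ← Finsupp.linearCombination_apply, incl_linearCombination]
  · rw [norm_incl]
    exact hc1 n
  · have h1 := hup a
    have h2 : sNorm a ≤ ‖Finsupp.linearCombination ℝ (fun n => incl (y n)) a‖ := by
      rw [incl_linearCombination, norm_incl]
      refine sNorm_le_of_blocks hyb _ _ fun n => ?_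
      rw [hyb.proj_linearCombination, sNorm_smul, hc1, mul_one]
    rw [← Finsupp.linearCombination_apply, ← Finsupp.linearCombination_apply, incl_eq, norm_incl]
    have := sNorm_nonneg a
    exact ⟨by linarith, h1⟩
  · have := topologicalClosure_span_eq_range hUV
    simp only [hV] at this
    rw [this]
    exact V.closedComplemented_range_of_leftInverse U hUV

/-! ### Gliding hump and complementable minimality. -/

/-- The gliding hump: an infinite-dimensional subspace contains almost finitely supported vectors
far out. -/
theorem exists_gliding {P : Submodule ℝ S} (hP : ¬ FiniteDimensional ℝ P) (N : ℕ) {δ : ℝ}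
    (hδ : 0 < δ) : ∃ w ∈ P, ∃ u : ℕ →₀ ℝ, (∀ p ∈ u.support, N ≤ p) ∧ 1 / 2 ≤ sNorm u ∧
      ‖w - incl u‖ ≤ δ := by
  classical
  have hcoord : ∀ i, ∃ φ : S →L[ℝ] ℝ, (∀ x, φ (incl x) = x i) ∧ ∀ s, ‖φ s‖ ≤ 1 * ‖s‖ := fun i =>
    exists_extension (Finsupp.lapply i) fun x => by
      rw [one_mul]
      exact abs_le_sNorm x i
  choose φ hφ hφ1 using hcoord
  let Φ : P →ₗ[ℝ] (Fin N → ℝ) :=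
    LinearMap.pi fun i => (φ i : S →ₗ[ℝ] ℝ) ∘ₗ P.subtype
  -- Finitely many coordinates cannot separate the points of an infinite-dimensional space.
  have hninj : ¬ Function.Injective Φ := fun h => hP (FiniteDimensional.of_injective Φ h)
  rw [← LinearMap.ker_eq_bot, Submodule.eq_bot_iff] at hninj
  push Not at hninj
  obtain ⟨⟨v, hv⟩, hvker, hv0⟩ := hninj
  have hv0 : v ≠ 0 := fun h => hv0 (Subtype.ext h)
  have hvφ : ∀ i < N, φ i v = 0 := fun i hi => congrFun (LinearMap.mem_ker.1 hvker) ⟨i, hi⟩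
  have hnv : 0 < ‖v‖ := norm_pos_iff.2 hv0
  set w : S := ‖v‖⁻¹ • v with hw
  have hw1 : ‖w‖ = 1 := by
    rw [hw, norm_smul, norm_inv, norm_norm, inv_mul_cancel₀ hnv.ne']
  have hwφ : ∀ i < N, φ i w = 0 := fun i hi => by rw [hw, map_smul, hvφ i hi, smul_zero]
  -- One share of the error pays for the approximation by `x`, and one for each of the `N` initial
  -- coordinates that are deleted.
  have hη : 0 < min δ (1 / 2) / (N + 1) := by positivity
  obtain ⟨x, hx⟩ := denseRange_incl.exists_dist_lt w hη
  rw [dist_eq_norm] at hx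
  set η := min δ (1 / 2) / (N + 1) with hηdef
  have hxi : ∀ i < N, |x i| ≤ η := by
    intro i hi
    have h1 := hφ1 i (w - incl x)
    rw [map_sub, hwφ i hi, hφ, zero_sub, norm_neg, Real.norm_eq_abs, one_mul] at h1
    exact h1.trans hx.le
  have hproj : sNorm (proj (Finset.range N) x) ≤ N * η := by
    refine (ciSup_le fun k => (iter_bounds k).2 _ : _ ≤ ell1 (proj (Finset.range N) x)).trans ?_
    unfold ell1
    refine (Finset.sum_le_sum_of_subset_of_nonneg ((support_proj_subset _ _).trans
      Finset.inter_subset_left) fun i _ _ => abs_nonneg _).trans ?_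
    refine (Finset.sum_le_sum fun i hi =>
      (abs_proj_le _ x i).trans (hxi i (Finset.mem_range.1 hi))).trans ?_
    simp
  have hdist : ‖w - incl (x - proj (Finset.range N) x)‖ ≤ min δ (1 / 2) := by
    have h1 : w - incl (x - proj (Finset.range N) x) =
        (w - incl x) + incl (proj (Finset.range N) x) := by
      rw [map_sub]; abel
    rw [h1]
    refine (norm_add_le _ _).trans ?_
    rw [norm_incl]
    have h2 : (N + 1) * η = min δ (1 / 2) := by rw [hηdef]; field_simp
    linarith
  refine ⟨w, P.smul_mem _ hv, x - proj (Finset.range N) x, fun p hp => ?_, ?_,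
    hdist.trans (min_le_left _ _)⟩
  · by_contra! h
    refine Finsupp.mem_support_iff.1 hp ?_
    rw [Finsupp.sub_apply, proj_apply, if_pos (Finset.mem_range.2 h), sub_self]
  · rw [← norm_incl]
    have h1 := norm_sub_norm_le w (incl (x - proj (Finset.range N) x))
    have h2 := hdist.trans (min_le_right _ _)
    linarith

theorem exists_block_near {P : Submodule ℝ S} (hP : ¬ FiniteDimensional ℝ P) {δ : ℕ → ℝ}
    (hδ : ∀ n, 0 < δ n) : ∃ (w : ℕ → S) (u : ℕ → ℕ →₀ ℝ), (∀ n, w n ∈ P) ∧ IsBlock u ∧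
      (∀ n, 1 / 2 ≤ sNorm (u n)) ∧ ∀ n, ‖w n - incl (u n)‖ ≤ δ n := by
  choose w hw u hu1 hu2 hu3 using fun n N => exists_gliding hP N (hδ n)
  set st : ℕ → ℕ := fun n => Nat.rec 0 (fun n s => max s ((u n s).support.sup id + 1)) n with hst
  have hst1 : ∀ n, st (n + 1) = max (st n) ((u n (st n)).support.sup id + 1) := fun n => rfl
  have hmono : Monotone st := monotone_nat_of_le_succ fun n => by
    rw [hst1]; exact le_max_left _ _
  refine ⟨fun n => w n (st n), fun n => u n (st n), fun n => hw n _, ?_, fun n => hu2 n _,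
    fun n => hu3 n _⟩
  intro m n hmn p hp q hq
  have h1 : p < st (m + 1) := by
    rw [hst1]
    exact (Nat.lt_succ_of_le (Finset.le_sup (f := id) hp)).trans_le (le_max_right _ _)
  exact h1.trans_le ((hmono (Nat.succ_le_of_lt hmn)).trans (hu1 n _ q hq))

/-- The good blocks are taken in the span of the approximants `u`. The same coefficients applied to
`w` give vectors of `P`, and the difference is a small operator `D`. Then `U (V + D) = 1 + U D` is
invertible, so `V + D` has a left inverse and range in `P`. -/
theorem complementablyMinimal : ComplementablyMinimal S := by
  intro P hP hinf
  obtain ⟨w, u, hw, hu, hu2, hwu⟩ := exists_block_near hinf (δ := fun n => 1 / 16 * (1 / 4) ^ n)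
    fun n => by positivity
  have hu0 : ∀ n, u n ≠ 0 := fun n h => by
    have := hu2 n
    rw [h, sNorm_zero] at this
    norm_num at this
  obtain ⟨c, hc, hc1, hc24⟩ := hu.exists_block hu0
  have hc0 : ∀ n, c n ≠ 0 := fun n h => by
    have := hc1 n
    rw [h, map_zero, sNorm_zero] at this
    exact zero_ne_one this
  set y : ℕ → ℕ →₀ ℝ := fun n => Finsupp.linearCombination ℝ u (c n) with hy
  have hyb : IsBlock y := fun m n hmn => hu.before_linearCombination (hc m n hmn)
  -- Restricting the normalized vector `y n` to the support of `u i` leaves `c n i • u i`, and `u i`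
  -- has norm at least `1 / 2`.
  have hc2 : ∀ n i, |c n i| ≤ 2 := by
    intro n i
    have h1 := sNorm_proj_le (u i).support (y n)
    rw [hy, hu.proj_linearCombination, sNorm_smul, hc1] at h1
    nlinarith [hu2 i, abs_nonneg (c n i)]
  set d : ℕ → S := fun n => Finsupp.linearCombination ℝ (fun i => w i - incl (u i)) (c n) with hd
  have hdn : ∀ n, ‖d n‖ ≤ 1 / 4 * (1 / 2) ^ n := by
    intro n
    rw [hd]
    simp only [Finsupp.linearCombination_apply, Finsupp.sum]
    calc ‖∑ i ∈ (c n).support, c n i • (w i - incl (u i))‖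
        ≤ ∑ i ∈ (c n).support, 1 / 8 * (1 / 2) ^ n * (1 / 2) ^ i := by
          refine norm_sum_le_of_le _ fun i hi => ?_
          rw [norm_smul, Real.norm_eq_abs]
          -- The `n`-th block uses only indices `i ≥ n`, so the decay `4 ^ (-i)` yields decay in `n`
          -- and a summable factor in `i`.
          have hle := hc.le_of_mem_support hc0 hi
          have h1 : (1 / 4 : ℝ) ^ i ≤ (1 / 2) ^ n * (1 / 2) ^ i := by
            rw [show (1 / 4 : ℝ) = 1 / 2 * (1 / 2) by norm_num, mul_pow]
            exact mul_le_mul_of_nonneg_right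
              (pow_le_pow_of_le_one (by norm_num) (by norm_num) hle) (by positivity)
          have h2 := mul_le_mul (hc2 n i) (hwu i) (norm_nonneg _) (by norm_num)
          linarith
      _ = 1 / 8 * (1 / 2) ^ n * ∑ i ∈ (c n).support, (1 / 2 : ℝ) ^ i := by rw [Finset.mul_sum]
      _ ≤ 1 / 8 * (1 / 2) ^ n * 2 :=
          mul_le_mul_of_nonneg_left (sum_half_pow_le _) (by positivity)
      _ = 1 / 4 * (1 / 2) ^ n := by ring
  obtain ⟨V, hV, -⟩ := exists_operator (fun n => incl (y n)) (C := 24) fun a => by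
    rw [incl_linearCombination, norm_incl]
    exact hc24 a
  obtain ⟨D, hD, hD2⟩ := exists_operator d (C := 1 / 2) fun a => by
    simp only [Finsupp.linearCombination_apply, Finsupp.sum]
    calc ‖∑ n ∈ a.support, a n • d n‖
        ≤ ∑ n ∈ a.support, sNorm a * (1 / 4) * (1 / 2) ^ n := by
          refine norm_sum_le_of_le _ fun n _ => ?_
          rw [norm_smul, Real.norm_eq_abs, mul_assoc]
          exact mul_le_mul (abs_le_sNorm a n) (hdn n) (norm_nonneg _) (sNorm_nonneg a)
      _ = sNorm a * (1 / 4) * ∑ n ∈ a.support, (1 / 2 : ℝ) ^ n := by rw [Finset.mul_sum]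
      _ ≤ sNorm a * (1 / 4) * 2 := mul_le_mul_of_nonneg_left (sum_half_pow_le _)
          (mul_nonneg (sNorm_nonneg a) (by norm_num))
      _ = 1 / 2 * sNorm a := by ring
  obtain ⟨U, hU1, hU⟩ := hyb.exists_coordinates hc1
  have hUV := leftInverse_of_basis (U := U) (V := V) fun n => by rw [hV, hU]
  have hsmall : ‖-(U * D)‖ < 1 := by
    refine lt_of_le_of_lt (ContinuousLinearMap.opNorm_le_bound _ (M := 1 / 2) (by norm_num)
      fun s => ?_) (by norm_num)
    rw [neg_apply, norm_neg]
    exact (hU1 _).trans (hD2 s)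
  obtain ⟨B, hB⟩ := (isUnit_one_sub_of_norm_lt_one hsmall).exists_left_inv
  refine exists_complemented_of_leftInverse (U := B * U) (V := V + D) (fun s => ?_) hP fun n => ?_
  · have h1 := congrArg (fun T : S →L[ℝ] S => T s) hB
    simpa [hUV] using h1
  · have h1 : (V + D) (e n) = Finsupp.linearCombination ℝ w (c n) := by
      rw [add_apply, hV, hD, hd, hy]
      simp only
      rw [← incl_linearCombination]
      simp only [Finsupp.linearCombination_apply, Finsupp.sum]
      rw [← Finset.sum_add_distrib]
      exact Finset.sum_congr rfl fun i _ => by rw [← smul_add, add_sub_cancel]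
    rw [h1, Finsupp.linearCombination_apply, Finsupp.sum]
    exact P.sum_mem fun i _ => P.smul_mem _ (hw i)

end SchlumprechtSpace

theorem theorem2p1 :
    ComplementablyMinimal SchlumprechtSpace.S ∧
    ∀ z : ℕ → SchlumprechtSpace.S, IsBlockBasisOf z SchlumprechtSpace.e →
      ∃ y : ℕ → SchlumprechtSpace.S, IsBlockBasisOf y z ∧ (∀ n, ‖y n‖ = 1) ∧
        EquivalentSeq y SchlumprechtSpace.e ∧
        (Submodule.span ℝ (Set.range y)).topologicalClosure.ClosedComplemented := by
  exact ⟨SchlumprechtSpace.complementablyMinimal,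
    SchlumprechtSpace.exists_subsequence_equivalent⟩
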